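/- **Setting.** Let $C\subset\mathbb R^N$ be a compact convex set with nonempty interior whose boundary is of class $C^2$, let $\nu$ be its outward unit normal, $T_c=\nu(c)^\perp$ the tangent space of $\partial C$ at $c$, and $S_c:T_c\to T_c$ the shape operator, $D\nu(c)[v]=-S_cv$. Let $\mathcal O_C$ be the class of open sets $\Omega\subset\mathbb R^N$ such that (1) $\operatorname{int}C\subset\Omega$; (2) $\partial\Omega$ is Lipschitz outside $C$; (3) for every $c\in\partial C$ the ray $\{c+t\nu(c):t\ge 0\}$ meets $\Omega$ in a connected (possibly empty) set; (4) for almost every $x\in\partial\Omega$ at which the inner unit normal $n(x)$ exists, the half-line $\{x+tn(x):t\ge0\}$ meets $C$. For $\Omega\in\mathcal O_C$ let $d(c)=\sup\{r\ge0: c+r\nu(c)\in\Omega\}$ be the thickness function (with $\sup\emptyset=0$), $\Phi(c)=c+d(c)\nu(c)$, $\pi(x)=x+t(x)n(x)$ with $t(x)$ the smallest $t\ge 0$ such that $x+tn(x)\in C$, and let $F=\pi\circ\Phi$ be the return map. Write $\nabla d$ for the Riemannian gradient of $d$ on $\partial C$ and $\mathrm{Crit}(d)=\{c\in\partial C:\nabla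 d(c)=0\}$. **Theorem.** For every such $C$ and every $D\in\mathbb R$ there is a constant $K>0$, depending only on $C$ and $D$, such that for every $\Omega\in\mathcal O_C$ whose thickness function is finite, of class $C^2$ on $\partial C$, and at most $D$, and for every $c\in\partial C\setminus\mathrm{Crit}(d)$: 1. The operator $I-d(c)S_c$ on $T_c$ is invertible, and $$\bigl\|F(c)-c-d(c)\,(I-d(c)S_c)^{-1}\nabla d(c)\bigr\|\le K\,d(c)\,\|\nabla d(c)\|^2 .$$ 2. The displacement $F(c)-c$ determines the descent direction, and hence the gradient line, of $d$ at $c$: if $w\in T_c$ is $I-d(c)S_c$ applied to the orthogonal projection of $F(c)-c$ onto $T_c$, then $w\neq0$, $$-\frac{\nabla d(c)}{\|\nabla d(c)\|}=-\frac{w}{\|w\|}\qquad\text{and}\qquad \operatorname{span}\bigl(\nabla d(c)\bigr)=\operatorname{span}(w).$$ 3. To leading order, as the thickness and its gradient become small, the displacement itself gives the descent direction, up to sign: $$\Bigl\|-\frac{\nabla d(c)}{\|\nabla d(c)\|}+\frac{F(c)-c}{\|F(c)-c\|}\Bigr\|\le K\bigl(d(c)+\|\nabla d(c)\|\bigr).$$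 -/

import Mathlib

open MeasureTheory
open scoped RealInnerProductSpace

noncomputable section

namespace ReturnMap

abbrev Space (N : ℕ) := EuclideanSpace ℝ (Fin N)

variable {N : ℕ}

/-- `n` is the inner unit normal of the set `A` at the boundary point `x`: in the limit
`y → x`, the points `y` on the side of `n` belong to `A`, and those on the opposite side
do not. Such a vector is unique. -/
def IsInnerUnitNormal (A : Set (Space N)) (x n : Space N) : Prop :=
  ‖n‖ = 1 ∧ x ∈ frontier A ∧
    ∀ ε > 0, ∃ δ > 0, ∀ y : Space N, ‖y - x‖ < δ →
      (ε * ‖y - x‖ < ⟪y - x, n⟫ → y ∈ A) ∧ (⟪y - x, n⟫ < -(ε * ‖y - x‖) → y ∉ A)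

open Classical in
/-- The inner unit normal of `A` at `x` (zero where there is none). -/
def innerNormal (A : Set (Space N)) (x : Space N) : Space N :=
  if h : ∃ n, IsInnerUnitNormal A x n then h.choose else 0

/-- The outward unit normal `ν(c)` of the core `C`. -/
def outerNormal (C : Set (Space N)) (c : Space N) : Space N := -innerNormal C c

/-- The boundary of `C` is of class `C²`: locally `C` is the sublevel set of a `C²` function
without critical points. -/
def HasC2Boundary (C : Set (Space N)) : Prop :=
  ∀ c ∈ frontier C, ∃ (U : Set (Space N)) (φ : Space N → ℝ), IsOpen U ∧ c ∈ U ∧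
    ContDiffOn ℝ 2 φ U ∧ (∀ x ∈ U, fderiv ℝ φ x ≠ 0) ∧
    (∀ x ∈ U, x ∈ frontier C ↔ φ x = 0) ∧ (∀ x ∈ U, x ∈ C ↔ φ x ≤ 0)

/-- A convex core: a compact convex set with nonempty interior and boundary of class `C²`. -/
structure IsConvexCore (C : Set (Space N)) : Prop where
  isCompact : IsCompact C
  convex : Convex ℝ C
  interior_nonempty : (interior C).Nonempty
  boundary : HasC2Boundary C

/-- Near each of its boundary points outside `C`, the set `Ω` is the region on one side of the
graph of a Lipschitz function over a hyperplane `eᗮ`. -/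
def LipschitzOutside (C Ω : Set (Space N)) : Prop :=
  ∀ x ∈ frontier Ω \ C, ∃ (U : Set (Space N)) (e : Space N) (h : Space N → ℝ) (L : NNReal),
    IsOpen U ∧ x ∈ U ∧ ‖e‖ = 1 ∧ LipschitzWith L h ∧
    ∀ y ∈ U, y ∈ Ω ↔ h (y - ⟪y, e⟫ • e) < ⟪y, e⟫

/-- The geometric normal property: at almost every boundary point (for the surface measure) that
has an inner unit normal, the inner normal half-line meets `C`. -/
def GeometricNormalProperty (C Ω : Set (Space N)) : Prop :=
  ∀ᵐ x ∂((Measure.hausdorffMeasure ((N : ℝ) - 1) : Measure (Space N)).restrict (frontier Ω)),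
    ∀ n, IsInnerUnitNormal Ω x n → ∃ t : ℝ, 0 ≤ t ∧ x + t • n ∈ C

/-- The outward normal ray issuing from `c`. -/
def normalRay (C : Set (Space N)) (c : Space N) : Set (Space N) :=
  {x | ∃ t : ℝ, 0 ≤ t ∧ x = c + t • outerNormal C c}

/-- The class `𝒪_C` of admissible domains. -/
structure ClassO (C Ω : Set (Space N)) : Prop where
  isOpen : IsOpen Ω
  interior_subset : interior C ⊆ Ω
  lipschitz : LipschitzOutside C Ω
  ray_connected : ∀ c ∈ frontier C, IsPreconnected (normalRay C c ∩ Ω)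
  normal_property : GeometricNormalProperty C Ω

/-- The thickness function `d(c) = sup {r ≥ 0 : c + r ν(c) ∈ Ω}`. -/
def thickness (C Ω : Set (Space N)) (c : Space N) : ℝ :=
  sSup {r : ℝ | 0 ≤ r ∧ c + r • outerNormal C c ∈ Ω}

/-- The radial map `Φ(c) = c + d(c) ν(c)`. -/
def radialMap (C Ω : Set (Space N)) (c : Space N) : Space N :=
  c + thickness C Ω c • outerNormal C c

/-- The length `t(x)` of the inner normal segment from `x` to `C`. -/
def hitTime (C Ω : Set (Space N)) (x : Space N) : ℝ :=
  sInf {t : ℝ | 0 ≤ t ∧ x + t • innerNormal Ω x ∈ C}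

/-- The reciprocal map `π(x) = x + t(x) n(x)`. -/
def reciprocalMap (C Ω : Set (Space N)) (x : Space N) : Space N :=
  x + hitTime C Ω x • innerNormal Ω x

/-- The return map `F = π ∘ Φ`. -/
def returnMap (C Ω : Set (Space N)) (c : Space N) : Space N :=
  reciprocalMap C Ω (radialMap C Ω c)

/-- The tangent space of `∂C` at `c`. -/
abbrev tangent (C : Set (Space N)) (c : Space N) : Submodule ℝ (Space N) :=
  (ℝ ∙ outerNormal C c)ᗮ

/-- The derivative at `c` along `∂C` of a map, as a linear map on the tangent space. (The ambient
`fderivWithin` is not unique in the normal direction, but its restriction to the tangent space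
is.) -/
def tangentDeriv {G : Type*} [NormedAddCommGroup G] [NormedSpace ℝ G] (C : Set (Space N))
    (f : Space N → G) (c : Space N) : tangent C c →L[ℝ] G :=
  (fderivWithin ℝ f (frontier C) c).comp (tangent C c).subtypeL

/-- The shape operator, `Dν(c)[v] = -S_c v`. The projection only changes the codomain, as `Dν(c)`
takes tangent values. -/
def shapeOperator (C : Set (Space N)) (c : Space N) : tangent C c →L[ℝ] tangent C c :=
  -((tangent C c).orthogonalProjectionOnto.comp (tangentDeriv C (outerNormal C) c))

/-- The Riemannian gradient of the thickness function on `∂C`. -/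
def gradThickness (C Ω : Set (Space N)) (c : Space N) : tangent C c :=
  (InnerProductSpace.toDual ℝ (tangent C c)).symm (tangentDeriv C (thickness C Ω) c)

/-- The critical set of the thickness function. -/
def criticalSet (C Ω : Set (Space N)) : Set (Space N) :=
  {c | c ∈ frontier C ∧ gradThickness C Ω c = 0}

/-- The operator `I - d(c) S_c` on the tangent space. -/
def transportOperator (C Ω : Set (Space N)) (c : Space N) : tangent C c →L[ℝ] tangent C c :=
  ContinuousLinearMap.id ℝ (tangent C c) - thickness C Ω c • shapeOperator C c

/-- The descent direction of the thickness function, `-∇d(c) / ‖∇d(c)‖`. -/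
def descentDirection (C Ω : Set (Space N)) (c : Space N) : tangent C c :=
  -(‖gradThickness C Ω c‖⁻¹ • gradThickness C Ω c)

/-- The displacement `F(c) - c`. -/
def displacement (C Ω : Set (Space N)) (c : Space N) : Space N :=
  returnMap C Ω c - c

/-- The vector `(I - d(c) S_c)` applied to the tangential part of the displacement. -/
def correctedDisplacement (C Ω : Set (Space N)) (c : Space N) : tangent C c :=
  transportOperator C Ω c ((tangent C c).orthogonalProjectionOnto (displacement C Ω c))

end ReturnMap

end

open ReturnMap

namespace ReturnMap

open Filter Topology

variable {N : ℕ}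

/-! Fix a noncritical `c` and write ν = ν(c), d = d(c), u = (I - dS)⁻¹∇d. Since `thickness` is
minimal where it vanishes, d > 0. Convexity makes ν monotone along ∂C, so -S ≥ 0 and I - dS ≥ I: it
is invertible for every d ≥ 0, and ‖u‖ ≤ ‖∇d‖.

In normal coordinates z = p + rν(p) near Φ(c), Ω is the sublevel set r - d(p) < 0
(`ClassO.eventually_mem_iff`), whose defining function has gradient ν - u at Φ(c)
(`IsConvexCore.exists_height`). The inner normal there is thus parallel to u - ν. Its half-line
meets C: missing C is an open condition, so otherwise the normal property would fail on a set of
positive surface measure (`ClassO.innerNormal_radialMap`). Therefore F(c) - c = dν + s(u - ν) for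
some s.

The tangential part is exactly su, and (I - dS)(su) = s∇d, which gives part 2 once s > 0. The error
in part 1 is exactly (s - d)(u - ν). The supporting hyperplane at c gives s ≥ d, and an interior
ball of radius R touching ∂C at c gives s - d ≤ 2d²‖u‖²/R, provided d‖u‖² ≤ κ
(`ClassO.exists_displacement_eq`). For larger d‖u‖², the bounds ‖F(c) - c‖ ≤ diam C and d ≤ D
suffice. Part 3 follows by normalizing, since ∇d - u = -dSu is small too. -/

/-! ### Inner unit normals -/

theorem IsInnerUnitNormal.eq {A : Set (Space N)} {x n m : Space N}
    (hn : IsInnerUnitNormal A x n) (hm : IsInnerUnitNormal A x m) : n = m := by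
  obtain ⟨hn1, -, hn⟩ := hn
  obtain ⟨hm1, -, hm⟩ := hm
  by_contra hne
  have hpos : 0 < ‖n - m‖ := norm_pos_iff.2 (sub_ne_zero.2 hne)
  have hsq : ‖n - m‖ ^ 2 = 2 * (1 - ⟪n, m⟫) := by
    rw [norm_sub_sq_real, hn1, hm1]; ring
  -- The direction n - m has inner product ‖n - m‖²/2 with n and the opposite with m, so a short
  -- step along it would land both inside and outside A. Any ε below ‖n - m‖/2 serves.
  have hε : 0 < ‖n - m‖ / 4 := by positivity
  obtain ⟨δ₁, hδ₁, h₁⟩ := hn _ hε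
  obtain ⟨δ₂, hδ₂, h₂⟩ := hm _ hε
  set s : ℝ := min δ₁ δ₂ / (2 * ‖n - m‖) with hs
  have hs0 : 0 < s := by positivity
  have hnorm : ‖(x + s • (n - m)) - x‖ = s * ‖n - m‖ := by
    rw [add_sub_cancel_left, norm_smul, Real.norm_of_nonneg hs0.le]
  have hlt : s * ‖n - m‖ < min δ₁ δ₂ := by
    have : s * ‖n - m‖ = min δ₁ δ₂ / 2 := by rw [hs]; field_simp
    rw [this]; linarith [lt_min hδ₁ hδ₂]
  have hin : ⟪(x + s • (n - m)) - x, n⟫ = s * (‖n - m‖ ^ 2 / 2) := by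
    rw [add_sub_cancel_left, real_inner_smul_left, inner_sub_left, real_inner_self_eq_norm_sq, hn1,
      real_inner_comm, hsq]; ring
  have him : ⟪(x + s • (n - m)) - x, m⟫ = -(s * (‖n - m‖ ^ 2 / 2)) := by
    rw [add_sub_cancel_left, real_inner_smul_left, inner_sub_left, real_inner_self_eq_norm_sq, hm1,
      hsq]; ring
  have key : ‖n - m‖ / 4 * (s * ‖n - m‖) < s * (‖n - m‖ ^ 2 / 2) := by
    have : 0 < s * ‖n - m‖ ^ 2 := by positivity
    nlinarith
  refine (h₂ (x + s • (n - m)) ?_).2 ?_ ((h₁ (x + s • (n - m)) ?_).1 ?_)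
  · rw [hnorm]; exact hlt.trans_le (min_le_right _ _)
  · rw [hnorm, him]; linarith
  · rw [hnorm]; exact hlt.trans_le (min_le_left _ _)
  · rw [hnorm, hin]; exact key

theorem IsInnerUnitNormal.innerNormal_eq {A : Set (Space N)} {x n : Space N}
    (hn : IsInnerUnitNormal A x n) : innerNormal A x = n := by
  have h : ∃ n, IsInnerUnitNormal A x n := ⟨n, hn⟩
  rw [innerNormal, dif_pos h]
  exact h.choose_spec.eq hn

/-- The inner unit normal of a sublevel set is the normalized negative gradient. -/
theorem isInnerUnitNormal_of_hasFDerivAt {A : Set (Space N)} {x G : Space N} {ρ : Space N → ℝ}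
    (hρ : HasFDerivAt ρ (innerSL ℝ G) x) (hG : G ≠ 0) (hx : ρ x = 0)
    (hneg : ∀ᶠ y in 𝓝 x, ρ y < 0 → y ∈ A) (hpos : ∀ᶠ y in 𝓝 x, 0 < ρ y → y ∉ A) :
    IsInnerUnitNormal A x (-(‖G‖⁻¹ • G)) := by
  have hG0 : 0 < ‖G‖ := norm_pos_iff.2 hG
  have hunit : ‖-(‖G‖⁻¹ • G)‖ = 1 := by
    rw [norm_neg, norm_smul, norm_inv, norm_norm, inv_mul_cancel₀ hG0.ne']
  have hside : ∀ ε > 0, ∃ δ > 0, ∀ y : Space N, ‖y - x‖ < δ →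
      (ε * ‖y - x‖ < ⟪y - x, -(‖G‖⁻¹ • G)⟫ → y ∈ A) ∧
      (⟪y - x, -(‖G‖⁻¹ • G)⟫ < -(ε * ‖y - x‖) → y ∉ A) := by
    intro ε hε
    have hlo := (hasFDerivAt_iff_isLittleO.1 hρ).def (c := ε * ‖G‖) (by positivity)
    obtain ⟨δ, hδ, h⟩ := Metric.eventually_nhds_iff.1 (hlo.and (hneg.and hpos))
    refine ⟨δ, hδ, fun y hy => ?_⟩
    obtain ⟨h1, h2, h3⟩ := h (by rwa [dist_eq_norm])
    rw [hx, sub_zero, innerSL_apply_apply, Real.norm_eq_abs, abs_le] at h1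
    have hin : ⟪y - x, -(‖G‖⁻¹ • G)⟫ = -(‖G‖⁻¹ * ⟪G, y - x⟫) := by
      rw [inner_neg_right, real_inner_smul_right, real_inner_comm]
    have hmul : ‖G‖ * (‖G‖⁻¹ * ⟪G, y - x⟫) = ⟪G, y - x⟫ := by field_simp
    rw [hin]
    constructor
    · intro h4
      apply h2
      have := mul_lt_mul_of_pos_left h4 hG0
      nlinarith [h1.2]
    · intro h4
      apply h3
      have := mul_lt_mul_of_pos_left h4 hG0
      nlinarith [h1.1]
  refine ⟨hunit, ?_, hside⟩
  -- The side condition alone puts x on the frontier: x + sn lies in A and x - sn outside for small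
  -- s > 0.
  obtain ⟨δ, hδ, h⟩ := hside (1 / 2) (by norm_num)
  set n := -(‖G‖⁻¹ • G) with hn
  have hself : ⟪n, n⟫ = 1 := by rw [real_inner_self_eq_norm_sq, hunit]; norm_num
  rw [frontier_eq_closure_inter_closure]
  have aux : ∀ η > 0, ∃ s : ℝ, 0 < s ∧ s < δ ∧ s < η := fun η hη =>
    ⟨min δ η / 2, by positivity, by linarith [min_le_left δ η, lt_min hδ hη],
      by linarith [min_le_right δ η, lt_min hδ hη]⟩
  constructor
  · refine Metric.mem_closure_iff.2 fun η hη => ?_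
    obtain ⟨s, hs, hsδ, hsη⟩ := aux η hη
    have hnm : ‖x + s • n - x‖ = s := by
      rw [add_sub_cancel_left, norm_smul, hunit, Real.norm_of_nonneg hs.le, mul_one]
    refine ⟨x + s • n, (h _ (by rw [hnm]; exact hsδ)).1 ?_, ?_⟩
    · rw [hnm, add_sub_cancel_left, real_inner_smul_left, hself]; linarith
    · rw [dist_comm, dist_eq_norm, hnm]; exact hsη
  · refine Metric.mem_closure_iff.2 fun η hη => ?_
    obtain ⟨s, hs, hsδ, hsη⟩ := aux η hη
    have hnm : ‖x - s • n - x‖ = s := by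
      rw [sub_sub_cancel_left, norm_neg, norm_smul, hunit, Real.norm_of_nonneg hs.le, mul_one]
    refine ⟨x - s • n, (h _ (by rw [hnm]; exact hsδ)).2 ?_, ?_⟩
    · rw [hnm, sub_sub_cancel_left, inner_neg_left, real_inner_smul_left, hself]; linarith
    · rw [dist_comm, dist_eq_norm, hnm]; exact hsη

/-! ### Local extension of the normal and supporting hyperplanes -/

/-- A vector field of class `C¹` extending the outward normal near `c`, together with a defining
function. -/
structure NormalExtension (C : Set (Space N)) (c : Space N) (φ : Space N → ℝ)
    (Nf : Space N → Space N) : Prop where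
  contDiffAt_defining : ContDiffAt ℝ 2 φ c
  contDiffAt_field : ContDiffAt ℝ 1 Nf c
  mem_frontier : ∀ᶠ y in 𝓝 c, φ y = 0 → y ∈ frontier C
  defining_eq_zero : φ c = 0
  outerNormal_eq : ∀ᶠ y in 𝓝 c, y ∈ frontier C → outerNormal C y = Nf y
  fderiv_defining : ∃ k : ℝ, 0 < k ∧ ∀ w, fderiv ℝ φ c w = k * ⟪Nf c, w⟫
  symm : ∀ v w, ⟪Nf c, v⟫ = 0 → ⟪Nf c, w⟫ = 0 →
    ⟪fderiv ℝ Nf c v, w⟫ = ⟪fderiv ℝ Nf c w, v⟫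

theorem gradient_ne_zero {φ : Space N → ℝ} {y : Space N} (h : fderiv ℝ φ y ≠ 0) :
    gradient φ y ≠ 0 := by
  intro h0
  apply h
  rw [gradient] at h0
  simpa using h0

theorem innerSL_gradient (φ : Space N → ℝ) (y : Space N) :
    innerSL ℝ (gradient φ y) = fderiv ℝ φ y := by
  ext w
  rw [innerSL_apply_apply, inner_gradient_left]

theorem HasC2Boundary.isInnerUnitNormal {C : Set (Space N)} {U : Set (Space N)} {φ : Space N → ℝ}
    (hU : IsOpen U) (hφ : ContDiffOn ℝ 2 φ U) (hne : ∀ x ∈ U, fderiv ℝ φ x ≠ 0)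
    (hfr : ∀ x ∈ U, x ∈ frontier C ↔ φ x = 0) (hle : ∀ x ∈ U, x ∈ C ↔ φ x ≤ 0)
    {y : Space N} (hy : y ∈ U) (hyC : y ∈ frontier C) :
    IsInnerUnitNormal C y (-(‖gradient φ y‖⁻¹ • gradient φ y)) := by
  have hd : DifferentiableAt ℝ φ y :=
    (hφ.contDiffAt (hU.mem_nhds hy)).differentiableAt (by norm_num)
  refine isInnerUnitNormal_of_hasFDerivAt (ρ := φ) ?_ (gradient_ne_zero (hne y hy))
    ((hfr y hy).1 hyC) ?_ ?_
  · rw [innerSL_gradient]; exact hd.hasFDerivAt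
  · filter_upwards [hU.mem_nhds hy] with z hz h
    exact (hle z hz).2 h.le
  · filter_upwards [hU.mem_nhds hy] with z hz h h'
    exact absurd ((hle z hz).1 h') (not_le.2 h)

theorem HasC2Boundary.exists_isInnerUnitNormal {C : Set (Space N)} (hC : HasC2Boundary C)
    {c : Space N} (hc : c ∈ frontier C) : IsInnerUnitNormal C c (-outerNormal C c) := by
  obtain ⟨U, φ, hU, hcU, hφ, hne, hfr, hle⟩ := hC c hc
  have h := HasC2Boundary.isInnerUnitNormal hU hφ hne hfr hle hcU hc
  rwa [outerNormal, neg_neg, h.innerNormal_eq]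

theorem HasC2Boundary.norm_outerNormal {C : Set (Space N)} (hC : HasC2Boundary C)
    {c : Space N} (hc : c ∈ frontier C) : ‖outerNormal C c‖ = 1 := by
  simpa using (hC.exists_isInnerUnitNormal hc).1

theorem HasC2Boundary.exists_normalExtension {C : Set (Space N)} (hC : HasC2Boundary C)
    {c : Space N} (hc : c ∈ frontier C) : ∃ φ Nf, NormalExtension C c φ Nf := by
  obtain ⟨U, φ, hU, hcU, hφ, hne, hfr, hle⟩ := hC c hc
  have hcd : ContDiffAt ℝ 2 φ c := hφ.contDiffAt (hU.mem_nhds hcU)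
  have hD : ContDiffAt ℝ 1 (fderiv ℝ φ) c := hcd.fderiv_right (by norm_num)
  have hgrad : ContDiffAt ℝ 1 (gradient φ) c :=
    ((InnerProductSpace.toDual ℝ (Space N)).symm.contDiff.contDiffAt).comp c hD
  have hg0 : gradient φ c ≠ 0 := gradient_ne_zero (hne c hcU)
  have hk : 0 < ‖gradient φ c‖ := norm_pos_iff.2 hg0
  have hinv : ContDiffAt ℝ 1 (fun y => ‖gradient φ y‖⁻¹) c :=
    (hgrad.norm ℝ hg0).inv hk.ne'
  have hNf : ContDiffAt ℝ 1 (fun y => ‖gradient φ y‖⁻¹ • gradient φ y) c := hinv.smul hgrad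
  -- Against tangent w the derivative of the factor 1/‖∇φ‖ drops out. What remains is a multiple of
  -- the Hessian of φ, hence symmetric on tangent vectors.
  have hformula : ∀ v w : Space N, ⟪gradient φ c, w⟫ = 0 →
      ⟪fderiv ℝ (fun y => ‖gradient φ y‖⁻¹ • gradient φ y) c v, w⟫ =
        ‖gradient φ c‖⁻¹ * fderiv ℝ (fderiv ℝ φ) c v w := by
    intro v w hw
    have h1 : HasFDerivAt (fun y => ⟪w, ‖gradient φ y‖⁻¹ • gradient φ y⟫)
        ((innerSL ℝ w).comp (fderiv ℝ (fun y => ‖gradient φ y‖⁻¹ • gradient φ y) c)) c :=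
      (innerSL ℝ w).hasFDerivAt.comp c (hNf.differentiableAt (by norm_num)).hasFDerivAt
    have h2 : HasFDerivAt (fun y => fderiv ℝ φ y w)
        ((ContinuousLinearMap.apply ℝ ℝ w).comp (fderiv ℝ (fderiv ℝ φ) c)) c :=
      (ContinuousLinearMap.apply ℝ ℝ w).hasFDerivAt.comp c
        (hD.differentiableAt (by norm_num)).hasFDerivAt
    have h3 := (hinv.differentiableAt (by norm_num)).hasFDerivAt.mul h2
    have heq : (fun y => ⟪w, ‖gradient φ y‖⁻¹ • gradient φ y⟫) =
        (fun y => ‖gradient φ y‖⁻¹ * fderiv ℝ φ y w) := by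
      ext y
      rw [real_inner_smul_right, real_inner_comm, inner_gradient_left]
    rw [heq] at h1
    have h4 := congrArg (fun L => L v) (h1.unique h3)
    have hw' : fderiv ℝ φ c w = 0 := by rw [← inner_gradient_left, hw]
    simp only [ContinuousLinearMap.comp_apply, innerSL_apply_apply, add_apply, smul_apply,
      ContinuousLinearMap.apply_apply, hw', smul_eq_mul, zero_mul, add_zero] at h4
    rw [real_inner_comm, h4]
  refine ⟨φ, fun y => ‖gradient φ y‖⁻¹ • gradient φ y, hcd, hNf, ?_, (hfr c hcU).1 hc, ?_, ?_, ?_⟩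
  · filter_upwards [hU.mem_nhds hcU] with y hy h using (hfr y hy).2 h
  · filter_upwards [hU.mem_nhds hcU] with y hy h
    rw [outerNormal, (HasC2Boundary.isInnerUnitNormal hU hφ hne hfr hle hy h).innerNormal_eq,
      neg_neg]
  · refine ⟨‖gradient φ c‖, hk, fun w => ?_⟩
    rw [real_inner_smul_left, inner_gradient_left]
    field_simp
  · intro v w hv hw
    have aux : ∀ v, ⟪‖gradient φ c‖⁻¹ • gradient φ c, v⟫ = 0 → ⟪gradient φ c, v⟫ = 0 := by
      intro v hv
      rw [real_inner_smul_left] at hv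
      exact (mul_eq_zero.1 hv).resolve_left (inv_ne_zero hk.ne')
    rw [hformula v w (aux w hw), hformula w v (aux v hv)]
    congr 1
    exact (hcd.isSymmSndFDerivAt (by simp)) v w

/-- The tangent hyperplane supports the convex set. -/
theorem IsConvexCore.inner_outerNormal_nonpos {C : Set (Space N)} (hC : IsConvexCore C)
    {c y : Space N} (hc : c ∈ frontier C) (hy : y ∈ C) : ⟪y - c, outerNormal C c⟫ ≤ 0 := by
  by_contra! hpos
  obtain ⟨-, -, h⟩ := hC.boundary.exists_isInnerUnitNormal hc
  have hcC : c ∈ C := hC.isCompact.isClosed.frontier_subset hc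
  have hy0 : 0 < ‖y - c‖ := by
    rw [norm_pos_iff]; rintro h0; rw [h0, inner_zero_left] at hpos; exact lt_irrefl _ hpos
  obtain ⟨δ, hδ, h⟩ := h (⟪y - c, outerNormal C c⟫ / (2 * ‖y - c‖)) (by positivity)
  -- By convexity C contains points near c on the segment towards y, although these lie strictly on
  -- the side of ν, where there are no points of C.
  set s : ℝ := min 1 (δ / (2 * ‖y - c‖)) with hs
  have hs0 : 0 < s := by positivity
  have hmem : c + s • (y - c) ∈ C := hC.convex.add_smul_sub_mem hcC hy ⟨hs0.le, min_le_left _ _⟩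
  have hnm : ‖c + s • (y - c) - c‖ = s * ‖y - c‖ := by
    rw [add_sub_cancel_left, norm_smul, Real.norm_of_nonneg hs0.le]
  refine (h _ ?_).2 ?_ hmem
  · rw [hnm]
    calc s * ‖y - c‖ ≤ δ / (2 * ‖y - c‖) * ‖y - c‖ := by gcongr; exact min_le_right _ _
      _ = δ / 2 := by field_simp
      _ < δ := by linarith
  · rw [hnm, add_sub_cancel_left, inner_neg_right, real_inner_smul_left]
    have : ⟪y - c, outerNormal C c⟫ / (2 * ‖y - c‖) * (s * ‖y - c‖) =
        s * ⟪y - c, outerNormal C c⟫ / 2 := by field_simp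
    rw [this]
    nlinarith [mul_pos hs0 hpos]

/-! ### Normal coordinates -/

/-- `p` and `r` are normal coordinates with respect to `∂C`: near `x = c + d ν(c)` each point `z`
is `p z + r z ν(p z)` with `p z ∈ ∂C`. -/
structure NormalCoordinates (C : Set (Space N)) (c : Space N) (d : ℝ) (x : Space N)
    (p : Space N → Space N) (r : Space N → ℝ) : Prop where
  contDiffAt_foot : ContDiffAt ℝ 1 p x
  contDiffAt_height : ContDiffAt ℝ 1 r x
  foot_eq : p x = c
  height_eq : r x = d
  foot_mem : ∀ᶠ z in 𝓝 x, p z ∈ frontier C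
  eq_foot_add : ∀ᶠ z in 𝓝 x, z = p z + r z • outerNormal C (p z)

/-- The inverse function theorem applies to Ψ(q, t) = (q + tν(q), φ(q)), inverted along (z, 0) so
that the foot stays on ∂C. If (w, s) is in the kernel of its derivative, then w is tangent and
pairing with w gives ‖w‖² + d⟪Dν w, w⟫ = 0; `hpos` forces w = 0 and then s = 0. The last clause is
the derivative of Ψ(p, r) = (z, 0). -/
theorem NormalExtension.exists_normalCoordinates {C : Set (Space N)} {c : Space N}
    {φ : Space N → ℝ} {Nf : Space N → Space N} (h : NormalExtension C c φ Nf)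
    (hN : ‖Nf c‖ = 1) {d : ℝ}
    (hpos : ∀ v, ⟪Nf c, v⟫ = 0 → 0 ≤ d * ⟪fderiv ℝ Nf c v, v⟫) :
    ∃ p r, NormalCoordinates C c d (c + d • Nf c) p r ∧
      ∀ w, ⟪Nf c, fderiv ℝ p (c + d • Nf c) w⟫ = 0 ∧
        w = fderiv ℝ p (c + d • Nf c) w + d • fderiv ℝ Nf c (fderiv ℝ p (c + d • Nf c) w) +
          fderiv ℝ r (c + d • Nf c) w • Nf c := by
  set x := c + d • Nf c with hx
  obtain ⟨k, hk, hφ'⟩ := h.fderiv_defining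
  have hNN : ⟪Nf c, Nf c⟫ = 1 := by rw [real_inner_self_eq_norm_sq, hN]; norm_num
  let Ψ : Space N × ℝ → Space N × ℝ := fun q => (q.1 + q.2 • Nf q.1, φ q.1)
  have hΨ : ContDiffAt ℝ 1 Ψ (c, d) := by
    have hN1 : ContDiffAt ℝ 1 (fun q : Space N × ℝ => Nf q.1) (c, d) :=
      ContDiffAt.comp (c, d) (g := Nf) h.contDiffAt_field contDiffAt_fst
    have hφ1 : ContDiffAt ℝ 1 (fun q : Space N × ℝ => φ q.1) (c, d) :=
      ContDiffAt.comp (c, d) (g := φ) (h.contDiffAt_defining.of_le (by norm_num)) contDiffAt_fst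
    exact (contDiffAt_fst.add (contDiffAt_snd.smul hN1)).prodMk hφ1
  have hNd : HasFDerivAt Nf (fderiv ℝ Nf c) c :=
    (h.contDiffAt_field.differentiableAt (by norm_num)).hasFDerivAt
  have hφd : HasFDerivAt φ (fderiv ℝ φ c) c :=
    (h.contDiffAt_defining.differentiableAt (by norm_num)).hasFDerivAt
  have hfst : HasFDerivAt (fun q : Space N × ℝ => q.1) (ContinuousLinearMap.fst ℝ (Space N) ℝ)
    (c, d) := hasFDerivAt_fst
  have hsnd : HasFDerivAt (fun q : Space N × ℝ => q.2) (ContinuousLinearMap.snd ℝ (Space N) ℝ)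
    (c, d) := hasFDerivAt_snd
  have hN1 : HasFDerivAt (fun q : Space N × ℝ => Nf q.1)
      ((fderiv ℝ Nf c).comp (ContinuousLinearMap.fst ℝ (Space N) ℝ)) (c, d) :=
    HasFDerivAt.comp (c, d) (g := Nf) hNd hfst
  have hφ1 : HasFDerivAt (fun q : Space N × ℝ => φ q.1)
      ((fderiv ℝ φ c).comp (ContinuousLinearMap.fst ℝ (Space N) ℝ)) (c, d) :=
    HasFDerivAt.comp (c, d) (g := φ) hφd hfst
  have hΨ' := (hfst.add (hsnd.smul hN1)).prodMk hφ1
  set L : Space N × ℝ →L[ℝ] Space N × ℝ := ContinuousLinearMap.prod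
    (ContinuousLinearMap.fst ℝ (Space N) ℝ +
      (d • (fderiv ℝ Nf c).comp (ContinuousLinearMap.fst ℝ (Space N) ℝ) +
        (ContinuousLinearMap.snd ℝ (Space N) ℝ).smulRight (Nf c)))
    ((fderiv ℝ φ c).comp (ContinuousLinearMap.fst ℝ (Space N) ℝ)) with hL
  have hLd : HasFDerivAt Ψ L (c, d) := hΨ'
  have hLapp : ∀ w s, L (w, s) = (w + (d • fderiv ℝ Nf c w + s • Nf c), fderiv ℝ φ c w) :=
    fun w s => rfl
  have hLinj : Function.Injective L := by
    refine (injective_iff_map_eq_zero L).2 ?_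
    rintro ⟨w, s⟩ h0
    rw [hLapp, Prod.mk_eq_zero, hφ'] at h0
    obtain ⟨h1, h2⟩ := h0
    have hw : ⟪Nf c, w⟫ = 0 := (mul_eq_zero.1 h2).resolve_left hk.ne'
    have h3 := congrArg (fun z => ⟪z, w⟫) h1
    simp only [inner_add_left, real_inner_smul_left, hw, inner_zero_left] at h3
    have hw0 : w = 0 := by
      have := hpos w hw
      rw [← norm_eq_zero]
      rw [real_inner_self_eq_norm_sq] at h3
      nlinarith [norm_nonneg w]
    subst hw0
    simp only [map_zero, smul_zero, zero_add] at h1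
    have hs : s = 0 := by
      have := congrArg (fun z => ⟪z, Nf c⟫) h1
      simpa only [real_inner_smul_left, hNN, mul_one, inner_zero_left] using this
    rw [hs]; rfl
  let E : (Space N × ℝ) ≃L[ℝ] (Space N × ℝ) :=
    (LinearEquiv.ofInjectiveEndo (L : Space N × ℝ →ₗ[ℝ] Space N × ℝ) hLinj).toContinuousLinearEquiv
  have hE : (E : Space N × ℝ →L[ℝ] Space N × ℝ) = L := by ext1 <;> rfl
  have hEd : HasFDerivAt Ψ (E : Space N × ℝ →L[ℝ] Space N × ℝ) (c, d) := by rw [hE]; exact hLd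
  set G := hΨ.localInverse hEd (by norm_num) with hG
  have hΨx : Ψ (c, d) = (x, 0) := by simp only [Ψ, h.defining_eq_zero, hx]
  have hGx : G (x, 0) = (c, d) := by
    rw [← hΨx]; exact hΨ.localInverse_apply_image hEd (by norm_num)
  have hGc : ContDiffAt ℝ 1 G (x, 0) := by
    rw [← hΨx]; exact hΨ.to_localInverse hEd (by norm_num)
  have hright : ∀ᶠ q in 𝓝 (x, (0 : ℝ)), Ψ (G q) = q := by
    rw [← hΨx]
    exact (hΨ.hasStrictFDerivAt' hEd (by norm_num)).eventually_right_inverse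
  have hinc : ContDiffAt ℝ 1 (fun z : Space N => (z, (0 : ℝ))) x :=
    contDiffAt_id.prodMk contDiffAt_const
  have hGi : ContDiffAt ℝ 1 (fun z : Space N => G (z, 0)) x :=
    ContDiffAt.comp x (g := G) hGc hinc
  have hright' : ∀ᶠ z in 𝓝 x, Ψ (G (z, 0)) = (z, 0) :=
    hinc.continuousAt.eventually hright
  have hpc : ContDiffAt ℝ 1 (fun z : Space N => (G (z, 0)).1) x := hGi.fst
  have hrc : ContDiffAt ℝ 1 (fun z : Space N => (G (z, 0)).2) x := hGi.snd
  have hpx : (G (x, 0)).1 = c := by rw [hGx]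
  have hrx : (G (x, 0)).2 = d := by rw [hGx]
  have hpt : Tendsto (fun z : Space N => (G (z, 0)).1) (𝓝 x) (𝓝 c) := by
    have := hpc.continuousAt.tendsto
    rwa [hpx] at this
  have hmem : ∀ᶠ z in 𝓝 x, (G (z, 0)).1 ∈ frontier C := by
    filter_upwards [hright', hpt.eventually h.mem_frontier] with z h1 h2
    exact h2 (congrArg Prod.snd h1)
  refine ⟨fun z => (G (z, 0)).1, fun z => (G (z, 0)).2, ⟨hpc, hrc, hpx, hrx, hmem, ?_⟩, ?_⟩
  · filter_upwards [hmem, hright', hpt.eventually h.outerNormal_eq] with z h1 h2 h3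
    rw [h3 h1]
    exact (congrArg Prod.fst h2).symm
  · intro w
    have hpd := (hpc.differentiableAt (by norm_num)).hasFDerivAt
    have hrd := (hrc.differentiableAt (by norm_num)).hasFDerivAt
    have hNd' : HasFDerivAt Nf (fderiv ℝ Nf c) ((G (x, 0)).1) := by rw [hpx]; exact hNd
    have hφd' : HasFDerivAt φ (fderiv ℝ φ c) ((G (x, 0)).1) := by rw [hpx]; exact hφd
    have e1 := hpd.add (hrd.smul (HasFDerivAt.comp x (g := Nf) hNd' hpd))
    have e2 := HasFDerivAt.comp x (g := φ) hφd' hpd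
    have f1 := (e1.congr_of_eventuallyEq (f₁ := fun z => z)
      (hright'.mono fun z hz => (congrArg Prod.fst hz).symm)).unique (hasFDerivAt_id x)
    have f2 := (e2.congr_of_eventuallyEq (f₁ := fun _ => (0 : ℝ))
      (hright'.mono fun z hz => (congrArg Prod.snd hz).symm)).unique (hasFDerivAt_const 0 x)
    have g1 := congrArg (fun M => M w) f1
    have g2 := congrArg (fun M => M w) f2
    simp only [ContinuousLinearMap.comp_apply, hφ', zero_apply] at g2
    refine ⟨(mul_eq_zero.1 g2).resolve_left hk.ne', ?_⟩
    simp only [Function.comp_apply, hpx, hrx, add_apply, smul_apply,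
      ContinuousLinearMap.comp_apply, ContinuousLinearMap.smulRight_apply,
      ContinuousLinearMap.id_apply] at g1
    rw [add_assoc]
    exact g1.symm

/-! ### Differentiating the normal along the boundary -/

/-- Every tangent vector is the velocity of a curve in the boundary. -/
theorem HasC2Boundary.exists_curve {C : Set (Space N)} (hC : HasC2Boundary C) {c : Space N}
    (hc : c ∈ frontier C) {v : Space N} (hv : ⟪outerNormal C c, v⟫ = 0) :
    ∃ γ : ℝ → Space N, γ 0 = c ∧ HasDerivAt γ v 0 ∧ ∀ᶠ ε in 𝓝 0, γ ε ∈ frontier C := by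
  obtain ⟨φ, Nf, h⟩ := hC.exists_normalExtension hc
  have hNc : outerNormal C c = Nf c := h.outerNormal_eq.self_of_nhds hc
  rw [hNc] at hv
  have hN : ‖Nf c‖ = 1 := by rw [← hNc]; exact hC.norm_outerNormal hc
  -- At height 0 the positivity condition is trivial and the foot map is a C¹ retraction near c; the
  -- curve is the image of the line c + εv.
  obtain ⟨p, r, hp, hw⟩ := h.exists_normalCoordinates hN (d := 0) (by simp)
  obtain ⟨h1, h2⟩ := hw v
  simp only [zero_smul, add_zero] at h1 h2 hp
  have hNN : ⟪Nf c, Nf c⟫ = 1 := by rw [real_inner_self_eq_norm_sq, hN]; norm_num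
  have hr : fderiv ℝ r c v = 0 := by
    have := congrArg (fun z => ⟪Nf c, z⟫) h2
    simpa only [inner_add_right, real_inner_smul_right, h1, hv, hNN, zero_add, mul_one] using this.symm
  rw [hr, zero_smul, add_zero] at h2
  have hline : HasDerivAt (fun ε : ℝ => c + ε • v) v 0 := by
    simpa using ((hasDerivAt_id (0 : ℝ)).smul_const v).const_add c
  have hcont : Tendsto (fun ε : ℝ => c + ε • v) (𝓝 0) (𝓝 c) := by
    simpa using hline.continuousAt.tendsto
  refine ⟨fun ε => p (c + ε • v), by simpa using hp.foot_eq, ?_, hcont.eventually hp.foot_mem⟩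
  have hpd : HasFDerivAt p (fderiv ℝ p c) (c + (0 : ℝ) • v) := by
    simpa using (hp.contDiffAt_foot.differentiableAt (by norm_num)).hasFDerivAt
  have := hpd.comp_hasDerivAt (0 : ℝ) hline
  rwa [← h2] at this

/-- The derivative along the boundary does not depend on the extension. -/
theorem NormalExtension.fderivWithin_eq {C : Set (Space N)} (hC : HasC2Boundary C) {c : Space N}
    {φ : Space N → ℝ} {Nf : Space N → Space N} (h : NormalExtension C c φ Nf)
    (hc : c ∈ frontier C) {v : Space N} (hv : ⟪outerNormal C c, v⟫ = 0) :
    fderivWithin ℝ (outerNormal C) (frontier C) c v = fderiv ℝ Nf c v := by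
  have hNc : outerNormal C c = Nf c := h.outerNormal_eq.self_of_nhds hc
  have hNd : HasFDerivAt Nf (fderiv ℝ Nf c) c :=
    (h.contDiffAt_field.differentiableAt (by norm_num)).hasFDerivAt
  have hw : HasFDerivWithinAt (outerNormal C) (fderiv ℝ Nf c) (frontier C) c := by
    refine hNd.hasFDerivWithinAt.congr_of_eventuallyEq ?_ hNc
    exact eventually_nhdsWithin_iff.2 h.outerNormal_eq
  obtain ⟨γ, h0, hγ, hmem⟩ := hC.exists_curve hc hv
  subst h0
  have hmaps : ∀ᶠ ε in 𝓝[{ε | γ ε ∈ frontier C}] (0 : ℝ), γ ε ∈ frontier C :=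
    eventually_mem_nhdsWithin
  -- Derivatives within a hypersurface are not unique, but on v each of them equals the derivative
  -- of ν ∘ γ for a boundary curve γ of velocity v.
  have key : ∀ L : Space N →L[ℝ] Space N,
      HasFDerivWithinAt (outerNormal C) L (frontier C) (γ 0) →
        HasDerivAt (fun ε => outerNormal C (γ ε)) (L v) 0 := by
    intro L hL
    have := hL.comp_hasDerivWithinAt (0 : ℝ) (hγ.hasDerivWithinAt (s := {ε | γ ε ∈ frontier C}))
      (fun ε hε => hε)
    exact this.hasDerivAt hmem
  exact (key _ hw.differentiableWithinAt.hasFDerivWithinAt).unique (key _ hw)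

/-- The derivative of the normal along a curve in the boundary. -/
theorem HasC2Boundary.exists_curve_normal {C : Set (Space N)} (hC : HasC2Boundary C) {c : Space N}
    (hc : c ∈ frontier C) {v : Space N} (hv : ⟪outerNormal C c, v⟫ = 0) :
    ∃ γ : ℝ → Space N, γ 0 = c ∧ HasDerivAt γ v 0 ∧ (∀ᶠ ε in 𝓝 0, γ ε ∈ frontier C) ∧
      HasDerivAt (fun ε => outerNormal C (γ ε))
        (fderivWithin ℝ (outerNormal C) (frontier C) c v) 0 := by
  obtain ⟨φ, Nf, h⟩ := hC.exists_normalExtension hc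
  rw [h.fderivWithin_eq hC hc hv]
  obtain ⟨γ, h0, hγ, hmem⟩ := hC.exists_curve hc hv
  refine ⟨γ, h0, hγ, hmem, ?_⟩
  subst h0
  have hNd : HasFDerivAt Nf (fderiv ℝ Nf (γ 0)) (γ 0) :=
    (h.contDiffAt_field.differentiableAt (by norm_num)).hasFDerivAt
  refine (hNd.comp_hasDerivAt (0 : ℝ) hγ).congr_of_eventuallyEq ?_
  filter_upwards [hmem, hγ.continuousAt.eventually h.outerNormal_eq] with ε h1 h2 using h2 h1

/-- Differentiate ⟪ν, ν⟫ = 1 along a boundary curve. -/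
theorem HasC2Boundary.inner_fderivWithin_outerNormal {C : Set (Space N)} (hC : HasC2Boundary C)
    {c : Space N} (hc : c ∈ frontier C) {v : Space N} (hv : ⟪outerNormal C c, v⟫ = 0) :
    ⟪outerNormal C c, fderivWithin ℝ (outerNormal C) (frontier C) c v⟫ = 0 := by
  obtain ⟨γ, h0, -, hmem, hν⟩ := hC.exists_curve_normal hc hv
  have h1 := hν.inner ℝ hν
  have h2 : HasDerivAt (fun _ : ℝ => (1 : ℝ)) 0 (0 : ℝ) := hasDerivAt_const _ _
  have h3 := (h2.congr_of_eventuallyEq (f₁ := fun ε => ⟪outerNormal C (γ ε), outerNormal C (γ ε)⟫)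
    (hmem.mono fun ε hε => by
      simp [hC.norm_outerNormal hε])).unique h1
  rw [h0, real_inner_comm (outerNormal C c)] at h3
  linarith

theorem HasC2Boundary.fderivWithin_outerNormal_symm {C : Set (Space N)} (hC : HasC2Boundary C)
    {c : Space N} (hc : c ∈ frontier C) {v w : Space N} (hv : ⟪outerNormal C c, v⟫ = 0)
    (hw : ⟪outerNormal C c, w⟫ = 0) :
    ⟪fderivWithin ℝ (outerNormal C) (frontier C) c v, w⟫ =
      ⟪fderivWithin ℝ (outerNormal C) (frontier C) c w, v⟫ := by
  obtain ⟨φ, Nf, h⟩ := hC.exists_normalExtension hc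
  rw [h.fderivWithin_eq hC hc hv, h.fderivWithin_eq hC hc hw]
  rw [h.outerNormal_eq.self_of_nhds hc] at hv hw
  exact h.symm v w hv hw

/-- By convexity the outward normal is monotone along the boundary. -/
theorem IsConvexCore.inner_outerNormal_sub_nonneg {C : Set (Space N)} (hC : IsConvexCore C)
    {c c' : Space N} (hc : c ∈ frontier C) (hc' : c' ∈ frontier C) :
    0 ≤ ⟪outerNormal C c' - outerNormal C c, c' - c⟫ := by
  have hcl := hC.isCompact.isClosed.frontier_subset
  have h1 := hC.inner_outerNormal_nonpos hc (hcl hc')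
  have h2 := hC.inner_outerNormal_nonpos hc' (hcl hc)
  rw [real_inner_comm, inner_sub_right]
  have h3 : ⟪c - c', outerNormal C c'⟫ = -⟪c' - c, outerNormal C c'⟫ := by
    rw [← inner_neg_left, neg_sub]
  linarith

/-- This is the infinitesimal form of the monotonicity of ν, obtained by dividing it by ε² along a
curve. It is what rules out focal points on the outward normals. -/
theorem IsConvexCore.inner_fderivWithin_nonneg {C : Set (Space N)} (hC : IsConvexCore C)
    {c : Space N} (hc : c ∈ frontier C) {v : Space N} (hv : ⟪outerNormal C c, v⟫ = 0) :
    0 ≤ ⟪fderivWithin ℝ (outerNormal C) (frontier C) c v, v⟫ := by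
  obtain ⟨γ, h0, hγ, hmem, hν⟩ := hC.boundary.exists_curve_normal hc hv
  rw [hasDerivAt_iff_tendsto_slope] at hγ hν
  refine ge_of_tendsto (hν.inner hγ) ?_
  filter_upwards [hmem.filter_mono nhdsWithin_le_nhds] with ε hε
  simp only [slope_def_module, h0, sub_zero, real_inner_smul_left, real_inner_smul_right]
  rw [← mul_assoc]
  exact mul_nonneg (mul_self_nonneg _) (hC.inner_outerNormal_sub_nonneg hc hε)

/-! ### Uniform interior ball and Lipschitz normal -/

theorem closedBall_sub_smul_subset {c n : Space N} (hn : ‖n‖ = 1) {R' R : ℝ} (h : R' ≤ R) :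
    Metric.closedBall (c - R' • n) R' ⊆ Metric.closedBall (c - R • n) R := by
  apply Metric.closedBall_subset_closedBall'
  rw [dist_eq_norm, show c - R' • n - (c - R • n) = (R - R') • n by module, norm_smul, hn,
    Real.norm_of_nonneg (by linarith)]
  linarith

/-- A `C²` boundary satisfies an interior ball condition locally. -/
theorem HasC2Boundary.exists_interior_ball_nhds {C : Set (Space N)} (hC : HasC2Boundary C)
    {c₀ : Space N} (hc₀ : c₀ ∈ frontier C) :
    ∃ R > 0, ∃ V ∈ 𝓝 c₀, ∀ c ∈ V, c ∈ frontier C →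
      Metric.closedBall (c - R • outerNormal C c) R ⊆ C := by
  obtain ⟨U, φ, hU, hcU, hφ, hne, hfr, hle⟩ := hC c₀ hc₀
  have hcd : ContDiffAt ℝ 2 φ c₀ := hφ.contDiffAt (hU.mem_nhds hcU)
  have hD : ContDiffAt ℝ 1 (fderiv ℝ φ) c₀ := hcd.fderiv_right (by norm_num)
  obtain ⟨K, t, ht, hK⟩ := hD.exists_lipschitzOnWith
  set m := ‖fderiv ℝ φ c₀‖ / 2 with hm
  have hm0 : 0 < m := by have := norm_pos_iff.2 (hne c₀ hcU); positivity
  have hgt : ∀ᶠ y in 𝓝 c₀, m < ‖fderiv ℝ φ y‖ :=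
    hD.continuousAt.norm.eventually_const_lt (by change m < ‖fderiv ℝ φ c₀‖; linarith)
  obtain ⟨δ, hδ, hball⟩ := Metric.eventually_nhds_iff_ball.1
    ((hU.eventually_mem hcU).and ((eventually_mem_set.2 ht).and hgt))
  -- The bound δ/8 keeps the ball where the estimates hold. The other gives 2KR ≤ m < ‖Dφ(c)‖: in
  -- the ball ‖y - c‖² ≤ -2R⟪y - c, n⟫, so the Taylor error K‖y - c‖² cannot outweigh the linear
  -- term ‖Dφ(c)‖⟪y - c, n⟫.
  set R := min (δ / 8) (m / (2 * (K + 1))) with hR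
  have hR0 : 0 < R := by positivity
  have hRK : 2 * K * R ≤ m := by
    have h1 : R ≤ m / (2 * (K + 1)) := min_le_right _ _
    rw [le_div_iff₀ (by positivity)] at h1
    nlinarith
  refine ⟨R, hR0, Metric.ball c₀ (δ / 2), Metric.ball_mem_nhds _ (by positivity), ?_⟩
  intro c hc hcC y hy
  have hcδ : c ∈ Metric.ball c₀ δ := Metric.ball_subset_ball (by linarith) hc
  obtain ⟨hcU', hct, hcm⟩ := hball c hcδ
  have hnorm := hC.norm_outerNormal hcC
  set n := outerNormal C c with hn
  have hνg : ‖fderiv ℝ φ c‖ • n = gradient φ c := by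
    rw [hn, outerNormal, (HasC2Boundary.isInnerUnitNormal hU hφ hne hfr hle hcU' hcC).innerNormal_eq,
      neg_neg, show ‖fderiv ℝ φ c‖ = ‖gradient φ c‖ by rw [← innerSL_gradient, innerSL_apply_norm],
      smul_smul, mul_inv_cancel₀ (norm_ne_zero_iff.2 (gradient_ne_zero (hne c hcU'))), one_smul]
  have hsq : ‖y - c‖ ^ 2 ≤ -2 * R * ⟪y - c, n⟫ := by
    rw [Metric.mem_closedBall, dist_eq_norm, show y - (c - R • n) = (y - c) + R • n by module] at hy
    have h1 : ‖y - c + R • n‖ ^ 2 ≤ R ^ 2 := by gcongr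
    rw [norm_add_sq_real, real_inner_smul_right, norm_smul, hnorm, Real.norm_of_nonneg hR0.le] at h1
    linarith
  have hyc : ‖y - c‖ ≤ 2 * R := by
    have h1 := abs_real_inner_le_norm (y - c) n
    rw [hnorm, mul_one] at h1
    have h2 := neg_abs_le ⟪y - c, n⟫
    by_contra! h3
    nlinarith
  have hsub : ∀ z ∈ Metric.closedBall c ‖y - c‖, z ∈ Metric.ball c₀ δ := by
    intro z hz
    rw [Metric.mem_closedBall] at hz
    rw [Metric.mem_ball] at hc ⊢
    have : R ≤ δ / 8 := min_le_left _ _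
    linarith [dist_triangle z c c₀]
  have hyb : y ∈ Metric.closedBall c ‖y - c‖ := by simp [dist_eq_norm]
  have htaylor := (convex_closedBall c ‖y - c‖).norm_image_sub_le_of_norm_hasFDerivWithin_le'
    (f := φ) (f' := fderiv ℝ φ) (φ := fderiv ℝ φ c) (C := K * ‖y - c‖) (x := c) (y := y)
    (fun z hz => ((hφ.contDiffAt (hU.mem_nhds (hball z (hsub z hz)).1)).differentiableAt
      (by norm_num)).hasFDerivAt.hasFDerivWithinAt)
    (fun z hz => by
      have h1 := hK.norm_sub_le (hball z (hsub z hz)).2.1 hct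
      rw [Metric.mem_closedBall, dist_eq_norm] at hz
      exact h1.trans (by gcongr))
    (by simp) hyb
  have hyU := (hball y (hsub y hyb)).1
  rw [hle y hyU]
  rw [(hfr c hcU').1 hcC, sub_zero, Real.norm_eq_abs, ← inner_gradient_left, ← hνg,
    real_inner_smul_left, real_inner_comm] at htaylor
  have h1 := (abs_le.1 htaylor).2
  have hq : ⟪y - c, n⟫ ≤ 0 := by nlinarith [sq_nonneg ‖y - c‖]
  have h2 : (K : ℝ) * ‖y - c‖ * ‖y - c‖ ≤ K * (-2 * R * ⟪y - c, n⟫) := by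
    rw [mul_assoc, ← sq]; gcongr
  nlinarith [mul_nonneg_of_nonpos_of_nonpos hq (by linarith : 2 * K * R - ‖fderiv ℝ φ c‖ ≤ 0)]

/-- A convex core satisfies a uniform interior ball condition. -/
theorem IsConvexCore.exists_interior_ball {C : Set (Space N)} (hC : IsConvexCore C) :
    ∃ R > 0, ∀ c ∈ frontier C, Metric.closedBall (c - R • outerNormal C c) R ⊆ C := by
  have hcomp : IsCompact (frontier C) := hC.isCompact.of_isClosed_subset isClosed_frontier
    hC.isCompact.isClosed.frontier_subset
  have key : ∃ R > 0, ∀ c ∈ frontier C, c ∈ frontier C →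
      Metric.closedBall (c - R • outerNormal C c) R ⊆ C := by
    -- Local radii are glued by compactness; a union takes the smaller radius, since balls tangent
    -- at c from the same side are nested.
    refine hcomp.induction_on (p := fun s => ∃ R > 0, ∀ c ∈ s, c ∈ frontier C →
      Metric.closedBall (c - R • outerNormal C c) R ⊆ C) ⟨1, one_pos, by simp⟩ ?_ ?_ ?_
    · rintro s t hst ⟨R, hR, h⟩
      exact ⟨R, hR, fun c hc => h c (hst hc)⟩
    · rintro s t ⟨R, hR, h⟩ ⟨R', hR', h'⟩
      refine ⟨min R R', lt_min hR hR', ?_⟩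
      rintro c (hc | hc) hcC
      · exact (closedBall_sub_smul_subset (hC.boundary.norm_outerNormal hcC)
          (min_le_left _ _)).trans (h c hc hcC)
      · exact (closedBall_sub_smul_subset (hC.boundary.norm_outerNormal hcC)
          (min_le_right _ _)).trans (h' c hc hcC)
    · intro c hc
      obtain ⟨R, hR, V, hV, h⟩ := hC.boundary.exists_interior_ball_nhds hc
      exact ⟨V, mem_nhdsWithin_of_mem_nhds hV, R, hR, h⟩
  obtain ⟨R, hR, h⟩ := key
  exact ⟨R, hR, fun c hc => h c hc hc⟩

/-- Test the supporting hyperplane at c' on the point of the interior ball at c that is farthest in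
the direction ν(c'). -/
theorem IsConvexCore.inner_ball_le {C : Set (Space N)} (hC : IsConvexCore C) {R : ℝ} (hR : 0 < R)
    (hball : ∀ c ∈ frontier C, Metric.closedBall (c - R • outerNormal C c) R ⊆ C)
    {c c' : Space N} (hc : c ∈ frontier C) (hc' : c' ∈ frontier C) :
    R * ‖outerNormal C c' - outerNormal C c‖ ^ 2 / 2 ≤ ⟪c' - c, outerNormal C c'⟫ := by
  have hn := hC.boundary.norm_outerNormal hc
  have hn' := hC.boundary.norm_outerNormal hc'
  have hmem : c - R • outerNormal C c + R • outerNormal C c' ∈ C := by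
    apply hball c hc
    rw [Metric.mem_closedBall, dist_eq_norm, add_sub_cancel_left, norm_smul, hn',
      Real.norm_of_nonneg hR.le, mul_one]
  have h := hC.inner_outerNormal_nonpos hc' hmem
  rw [show c - R • outerNormal C c + R • outerNormal C c' - c' =
    R • (outerNormal C c' - outerNormal C c) - (c' - c) by module, inner_sub_left,
    real_inner_smul_left, inner_sub_left, real_inner_self_eq_norm_sq, hn'] at h
  rw [norm_sub_sq_real, hn, hn', real_inner_comm]
  linarith

/-- The interior ball condition makes the outward normal Lipschitz. -/
theorem IsConvexCore.norm_outerNormal_sub_le {C : Set (Space N)} (hC : IsConvexCore C) {R : ℝ}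
    (hR : 0 < R) (hball : ∀ c ∈ frontier C, Metric.closedBall (c - R • outerNormal C c) R ⊆ C)
    {c c' : Space N} (hc : c ∈ frontier C) (hc' : c' ∈ frontier C) :
    ‖outerNormal C c' - outerNormal C c‖ ≤ ‖c' - c‖ / R := by
  -- Adding the inequality to its mirror image gives R‖ν(c') - ν(c)‖² ≤ ⟪c' - c, ν(c') - ν(c)⟫;
  -- Cauchy–Schwarz concludes.
  have h1 := hC.inner_ball_le hR hball hc hc'
  have h2 := hC.inner_ball_le hR hball hc' hc
  rw [norm_sub_rev, show c - c' = -(c' - c) by abel, inner_neg_left] at h2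
  have h3 : ⟪c' - c, outerNormal C c' - outerNormal C c⟫ ≤
      ‖c' - c‖ * ‖outerNormal C c' - outerNormal C c‖ := real_inner_le_norm _ _
  rw [inner_sub_right] at h3
  rw [le_div_iff₀ hR]
  by_contra! h4
  have h5 : 0 < ‖outerNormal C c' - outerNormal C c‖ := by
    by_contra! h6
    nlinarith [norm_nonneg (c' - c)]
  nlinarith [mul_lt_mul_of_pos_right h4 h5]

theorem IsConvexCore.norm_fderivWithin_le {C : Set (Space N)} (hC : IsConvexCore C) {R : ℝ}
    (hR : 0 < R) (hball : ∀ c ∈ frontier C, Metric.closedBall (c - R • outerNormal C c) R ⊆ C)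
    {c : Space N} (hc : c ∈ frontier C) {v : Space N} (hv : ⟪outerNormal C c, v⟫ = 0) :
    ‖fderivWithin ℝ (outerNormal C) (frontier C) c v‖ ≤ ‖v‖ / R := by
  obtain ⟨γ, h0, hγ, hmem, hν⟩ := hC.boundary.exists_curve_normal hc hv
  rw [hasDerivAt_iff_tendsto_slope] at hγ hν
  refine le_of_tendsto_of_tendsto hν.norm (hγ.norm.div_const R) ?_
  filter_upwards [hmem.filter_mono nhdsWithin_le_nhds] with ε hε
  simp only [slope_def_module, h0, sub_zero, norm_smul]
  rw [mul_div_assoc]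
  gcongr
  exact hC.norm_outerNormal_sub_le hR hball hc hε

/-! ### The operator I - dS -/

theorem inner_outerNormal_of_mem_tangent {C : Set (Space N)} {c : Space N} (v : tangent C c) :
    ⟪outerNormal C c, (v : Space N)⟫ = 0 :=
  Submodule.mem_orthogonal_singleton_iff_inner_right.1 v.2

theorem HasC2Boundary.coe_shapeOperator {C : Set (Space N)} (hC : HasC2Boundary C) {c : Space N}
    (hc : c ∈ frontier C) (v : tangent C c) :
    (shapeOperator C c v : Space N) =
      -fderivWithin ℝ (outerNormal C) (frontier C) c (v : Space N) := by
  have hmem : fderivWithin ℝ (outerNormal C) (frontier C) c (v : Space N) ∈ tangent C c :=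
    Submodule.mem_orthogonal_singleton_iff_inner_right.2
      (hC.inner_fderivWithin_outerNormal hc (inner_outerNormal_of_mem_tangent v))
  have := (tangent C c).orthogonalProjectionOnto_mem_subspace_eq_self ⟨_, hmem⟩
  simp only [shapeOperator, tangentDeriv, neg_apply, ContinuousLinearMap.comp_apply,
    Submodule.subtypeL_apply, Submodule.coe_neg]
  rw [this]

theorem HasC2Boundary.coe_transportOperator {C : Set (Space N)} (hC : HasC2Boundary C)
    (Ω : Set (Space N)) {c : Space N} (hc : c ∈ frontier C) (v : tangent C c) :
    (transportOperator C Ω c v : Space N) =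
      v + thickness C Ω c • fderivWithin ℝ (outerNormal C) (frontier C) c (v : Space N) := by
  simp [transportOperator, hC.coe_shapeOperator hc]

theorem HasC2Boundary.inner_transportOperator {C : Set (Space N)} (hC : HasC2Boundary C)
    (Ω : Set (Space N)) {c : Space N} (hc : c ∈ frontier C) (v w : tangent C c) :
    ⟪transportOperator C Ω c v, w⟫ = ⟪v, transportOperator C Ω c w⟫ := by
  rw [Submodule.coe_inner, Submodule.coe_inner, hC.coe_transportOperator Ω hc,
    hC.coe_transportOperator Ω hc, inner_add_left, inner_add_right, real_inner_smul_left,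
    real_inner_smul_right, hC.fderivWithin_outerNormal_symm hc (inner_outerNormal_of_mem_tangent v)
      (inner_outerNormal_of_mem_tangent w), real_inner_comm (v : Space N)
      (fderivWithin ℝ (outerNormal C) (frontier C) c (w : Space N))]

/-- Convexity gives ⟪(I - dS)v, v⟫ ≥ ‖v‖². Both the invertibility and ‖(I - dS)⁻¹‖ ≤ 1 come from
here. -/
theorem IsConvexCore.norm_le_transportOperator {C Ω : Set (Space N)} (hC : IsConvexCore C)
    {c : Space N} (hc : c ∈ frontier C) (hd : 0 ≤ thickness C Ω c) (v : tangent C c) :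
    ‖v‖ ≤ ‖transportOperator C Ω c v‖ := by
  have h1 : ‖v‖ ^ 2 ≤ ⟪transportOperator C Ω c v, v⟫ := by
    rw [Submodule.coe_inner, hC.boundary.coe_transportOperator Ω hc, inner_add_left,
      real_inner_smul_left, real_inner_self_eq_norm_sq, Submodule.coe_norm]
    have := hC.inner_fderivWithin_nonneg hc (inner_outerNormal_of_mem_tangent v)
    nlinarith
  have h2 := real_inner_le_norm (transportOperator C Ω c v) v
  by_contra! h3
  nlinarith [norm_nonneg (transportOperator C Ω c v)]

theorem IsConvexCore.exists_equiv_transportOperator {C Ω : Set (Space N)} (hC : IsConvexCore C)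
    {c : Space N} (hc : c ∈ frontier C) (hd : 0 ≤ thickness C Ω c) :
    ∃ E : tangent C c ≃L[ℝ] tangent C c,
      (E : tangent C c →L[ℝ] tangent C c) = transportOperator C Ω c := by
  have hinj : Function.Injective
      (transportOperator C Ω c : tangent C c →ₗ[ℝ] tangent C c) := by
    refine (injective_iff_map_eq_zero _).2 fun v hv => ?_
    have h1 := hC.norm_le_transportOperator hc hd v
    have h2 : transportOperator C Ω c v = 0 := hv
    rw [h2, norm_zero] at h1
    exact norm_le_zero_iff.1 h1
  exact ⟨(LinearEquiv.ofInjectiveEndo _ hinj).toContinuousLinearEquiv, by ext v; rfl⟩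

theorem IsConvexCore.norm_transportOperator_sub_le {C Ω : Set (Space N)} (hC : IsConvexCore C)
    {R : ℝ} (hR : 0 < R)
    (hball : ∀ c ∈ frontier C, Metric.closedBall (c - R • outerNormal C c) R ⊆ C)
    {c : Space N} (hc : c ∈ frontier C) (hd : 0 ≤ thickness C Ω c) (v : tangent C c) :
    ‖transportOperator C Ω c v - v‖ ≤ thickness C Ω c * (‖v‖ / R) := by
  rw [Submodule.coe_norm, Submodule.coe_sub, hC.boundary.coe_transportOperator Ω hc,
    add_sub_cancel_left, norm_smul, Real.norm_of_nonneg hd, Submodule.coe_norm]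
  gcongr
  exact hC.norm_fderivWithin_le hR hball hc (inner_outerNormal_of_mem_tangent v)

/-! ### The height over the graph of the thickness function -/

theorem inner_gradThickness (C Ω : Set (Space N)) (c : Space N) (v : tangent C c) :
    ⟪(gradThickness C Ω c : Space N), (v : Space N)⟫ =
      fderivWithin ℝ (thickness C Ω) (frontier C) c v := by
  rw [← Submodule.coe_inner, gradThickness, InnerProductSpace.toDual_symm_apply]
  rfl

/-- The signed height over the graph of the thickness function, in normal coordinates, is of class
`C¹`, with gradient `ν - (I - d S)⁻¹ ∇d`. -/
theorem IsConvexCore.exists_height {C Ω : Set (Space N)} (hC : IsConvexCore C)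
    {c : Space N} (hc : c ∈ frontier C) (hd : 0 ≤ thickness C Ω c)
    (hth : ContDiffOn ℝ 2 (thickness C Ω) (frontier C)) {u : tangent C c}
    (hu : transportOperator C Ω c u = gradThickness C Ω c) :
    ∃ p r, NormalCoordinates C c (thickness C Ω c) (radialMap C Ω c) p r ∧
      ContDiffAt ℝ 1 (fun z => r z - thickness C Ω (p z)) (radialMap C Ω c) ∧
      HasFDerivAt (fun z => r z - thickness C Ω (p z)) (innerSL ℝ (outerNormal C c - (u : Space N)))
        (radialMap C Ω c) := by
  obtain ⟨φ, Nf, h⟩ := hC.boundary.exists_normalExtension hc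
  have hNc : outerNormal C c = Nf c := h.outerNormal_eq.self_of_nhds hc
  have hN : ‖Nf c‖ = 1 := by rw [← hNc]; exact hC.boundary.norm_outerNormal hc
  have hNN : ⟪Nf c, Nf c⟫ = 1 := by rw [real_inner_self_eq_norm_sq, hN]; norm_num
  obtain ⟨p, r, hp, hw⟩ := h.exists_normalCoordinates hN (d := thickness C Ω c) (by
    intro v hv
    rw [← hNc] at hv
    rw [← h.fderivWithin_eq hC.boundary hc hv]
    exact mul_nonneg hd (hC.inner_fderivWithin_nonneg hc hv))
  rw [← hNc] at hp hw hNN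
  change NormalCoordinates C c (thickness C Ω c) (radialMap C Ω c) p r at hp
  set x := radialMap C Ω c with hx
  have hthc : ContDiffAt ℝ 1 (fun z => thickness C Ω (p z)) x := by
    have h1 : ContDiffWithinAt ℝ 1 (thickness C Ω) (frontier C) (p x) := by
      rw [hp.foot_eq]; exact (hth c hc).of_le (by norm_num)
    have h2 : ContDiffWithinAt ℝ 1 p {z | p z ∈ frontier C} x :=
      hp.contDiffAt_foot.contDiffWithinAt
    exact (h1.comp x h2 (fun z hz => hz)).contDiffAt hp.foot_mem
  have hthd : HasFDerivAt (fun z => thickness C Ω (p z))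
      ((fderivWithin ℝ (thickness C Ω) (frontier C) c).comp (fderiv ℝ p x)) x := by
    have h1 : HasFDerivWithinAt (thickness C Ω) (fderivWithin ℝ (thickness C Ω) (frontier C) c)
        (frontier C) (p x) := by
      rw [hp.foot_eq]
      exact ((hth c hc).differentiableWithinAt (by norm_num)).hasFDerivWithinAt
    have h2 : HasFDerivWithinAt p (fderiv ℝ p x) {z | p z ∈ frontier C} x :=
      (hp.contDiffAt_foot.differentiableAt (by norm_num)).hasFDerivAt.hasFDerivWithinAt
    exact (h1.comp x h2 (fun z hz => hz)).hasFDerivAt hp.foot_mem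
  refine ⟨p, r, hp, hp.contDiffAt_height.sub hthc, ?_⟩
  have hrd := (hp.contDiffAt_height.differentiableAt (by norm_num)).hasFDerivAt
  refine (hrd.sub hthd).congr_fderiv (ContinuousLinearMap.ext fun w => Eq.symm ?_)
  obtain ⟨h1, h2⟩ := hw w
  change ⟪outerNormal C c, fderiv ℝ p x w⟫ = 0 at h1
  change w = fderiv ℝ p x w + thickness C Ω c • fderiv ℝ Nf c (fderiv ℝ p x w) +
    fderiv ℝ r x w • outerNormal C c at h2
  let v : tangent C c :=
    ⟨fderiv ℝ p x w, Submodule.mem_orthogonal_singleton_iff_inner_right.2 h1⟩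
  -- With v = Dp(w), pairing this decomposition with ν yields Dr(w). Pairing it with u and moving
  -- the symmetric operator onto u yields ⟪∇d, v⟫, the derivative of d ∘ p.
  have h3 : w = transportOperator C Ω c v + fderiv ℝ r x w • outerNormal C c := by
    rw [hC.boundary.coe_transportOperator Ω hc, h.fderivWithin_eq hC.boundary hc h1]
    exact h2
  have h4 : ⟪outerNormal C c, w⟫ = fderiv ℝ r x w := by
    have := congrArg (fun z => ⟪outerNormal C c, z⟫) h3
    simpa only [inner_add_right, real_inner_smul_right, hNN, mul_one, zero_add,
      inner_outerNormal_of_mem_tangent] using this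
  have h5 : ⟪(u : Space N), w⟫ = fderivWithin ℝ (thickness C Ω) (frontier C) c (v : Space N) := by
    have := congrArg (fun z => ⟪(u : Space N), z⟫) h3
    simp only [inner_add_right, real_inner_smul_right] at this
    rw [real_inner_comm (outerNormal C c), inner_outerNormal_of_mem_tangent, mul_zero, add_zero,
      ← Submodule.coe_inner, ← hC.boundary.inner_transportOperator Ω hc, hu,
      Submodule.coe_inner, inner_gradThickness] at this
    exact this
  rw [innerSL_apply_apply, inner_sub_left, h4, h5]
  rfl

/-! ### Lipschitz epigraphs -/

/-- A Lipschitz epigraph contained in the sublevel set of a `C¹` function, whose zero set it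
approaches, is locally the whole sublevel set. -/
theorem eventually_mem_of_sublevel {Ω U : Set (Space N)} {x e : Space N} {h : Space N → ℝ}
    {L : NNReal} (hU : IsOpen U) (hxU : x ∈ U) (he : ‖e‖ = 1) (hh : LipschitzWith L h)
    (hΩ : ∀ y ∈ U, y ∈ Ω ↔ h (y - ⟪y, e⟫ • e) < ⟪y, e⟫)
    {ρ : Space N → ℝ} {G : Space N} (hρ : ContDiffAt ℝ 1 ρ x)
    (hG : HasFDerivAt ρ (innerSL ℝ G) x) (hG0 : G ≠ 0) (hρx : ρ x = 0)
    (hneg : ∀ᶠ z in 𝓝 x, z ∈ Ω → ρ z < 0) (hzero : ∀ᶠ z in 𝓝 x, ρ z = 0 → z ∈ closure Ω) :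
    ∀ᶠ z in 𝓝 x, ρ z < 0 → z ∈ Ω := by
  have hee : ⟪e, e⟫ = 1 := by rw [real_inner_self_eq_norm_sq, he]; norm_num
  have hclos : ∀ y ∈ U, y ∈ closure Ω → h (y - ⟪y, e⟫ • e) ≤ ⟪y, e⟫ := by
    intro y hy hyΩ
    have h1 : y ∈ closure (U ∩ Ω) := hU.inter_closure ⟨hy, hyΩ⟩
    have h2 : IsClosed {y : Space N | h (y - ⟪y, e⟫ • e) ≤ ⟪y, e⟫} :=
      isClosed_le (hh.continuous.comp (by fun_prop)) (by fun_prop)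
    exact closure_minimal (fun z hz => ((hΩ z hz.1).1 hz.2).le) h2 h1
  have hxle := hclos x hxU (hzero.self_of_nhds hρx)
  -- The tilted direction e + ηG still lies in the cone of the Lipschitz graph for small η > 0, so ρ
  -- < 0 shortly along it and ⟪G, e⟫ + η‖G‖² ≤ 0. The direction e itself would give only a weak
  -- inequality.
  have htrans : ⟪G, e⟫ < 0 := by
    have hcone : ∀ᶠ η in 𝓝[>] (0 : ℝ),
        L * ‖(e + η • G) - ⟪e + η • G, e⟫ • e‖ < ⟪e + η • G, e⟫ := by
      refine Filter.Eventually.filter_mono nhdsWithin_le_nhds ?_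
      have hc1 : Continuous fun η : ℝ => L * ‖(e + η • G) - ⟪e + η • G, e⟫ • e‖ := by fun_prop
      have hc2 : Continuous fun η : ℝ => ⟪e + η • G, e⟫ := by fun_prop
      refine hc1.continuousAt.eventually_lt hc2.continuousAt ?_
      simp [he]
    obtain ⟨η, hη, hη0⟩ := (hcone.and self_mem_nhdsWithin).exists
    set w := e + η • G with hw
    have hline : HasDerivAt (fun s : ℝ => x + s • w) w 0 := by
      simpa using ((hasDerivAt_id (0 : ℝ)).smul_const w).const_add x
    have hcont : Tendsto (fun s : ℝ => x + s • w) (𝓝 0) (𝓝 x) := by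
      simpa using hline.continuousAt.tendsto
    have hG' : HasFDerivAt ρ (innerSL ℝ G) (x + (0 : ℝ) • w) := by simpa using hG
    have hder := hG'.comp_hasDerivAt (0 : ℝ) hline
    have hle : ⟪G, w⟫ ≤ 0 := by
      have := (hasDerivWithinAt_iff_tendsto_slope' (s := Set.Ioi 0) (by simp)).1
        (hder.hasDerivWithinAt (s := Set.Ioi (0 : ℝ)))
      refine le_of_tendsto this ?_
      filter_upwards [self_mem_nhdsWithin, nhdsWithin_le_nhds (hcont.eventually hneg),
        nhdsWithin_le_nhds (hcont.eventually (hU.eventually_mem hxU))] with s hs h1 h2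
      have hs0 : 0 < s := hs
      have h3 : x + s • w ∈ Ω := by
        rw [hΩ _ h2]
        have h4 := hh.dist_le_mul (x + s • w - ⟪x + s • w, e⟫ • e) (x - ⟪x, e⟫ • e)
        rw [Real.dist_eq, dist_eq_norm] at h4
        have h5 : x + s • w - ⟪x + s • w, e⟫ • e - (x - ⟪x, e⟫ • e) = s • (w - ⟪w, e⟫ • e) := by
          rw [inner_add_left, real_inner_smul_left]; module
        rw [h5, norm_smul, Real.norm_of_nonneg hs0.le] at h4
        have h6 := (abs_le.1 h4).2
        have h7 : ⟪x + s • w, e⟫ = ⟪x, e⟫ + s * ⟪w, e⟫ := by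
          rw [inner_add_left, real_inner_smul_left]
        nlinarith [mul_lt_mul_of_pos_left hη hs0]
      have h7 := h1 h3
      simp only [slope_def_field, Function.comp_apply, zero_smul, add_zero, hρx, sub_zero]
      exact div_nonpos_of_nonpos_of_nonneg h7.le hs0.le
    rw [hw, inner_add_right, real_inner_smul_right, real_inner_self_eq_norm_sq] at hle
    have hη0' : 0 < η := hη0
    have : 0 < η * ‖G‖ ^ 2 := by have := norm_pos_iff.2 hG0; positivity
    linarith
  -- Along -e, ρ grows at rate at least 2κ - κ, the second κ being the error in strict
  -- differentiability. Descending from z, ρ vanishes within distance -ρ(z)/κ; the point reached is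
  -- in the closure of Ω, hence on or above the graph, and z is strictly higher.
  set κ := -⟪G, e⟫ / 2 with hκ
  have hκ0 : 0 < κ := by linarith
  have hstrict : HasStrictFDerivAt ρ (innerSL ℝ G) x := hρ.hasStrictFDerivAt' hG (by norm_num)
  have hinc := (hasStrictFDerivAt_iff_isLittleO.1 hstrict).def hκ0
  rw [nhds_prod_eq] at hinc
  obtain ⟨δ, hδ, hprod⟩ := Metric.eventually_nhds_iff_ball.1
    ((hU.eventually_mem hxU).and (hzero.and (hρ.eventually (by simp))))
  obtain ⟨P, hP, hPinc⟩ := Filter.eventually_prod_self_iff'.1 hinc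
  obtain ⟨δ', hδ', hPball⟩ := Metric.eventually_nhds_iff_ball.1 hP
  have hsmall : ∀ᶠ z in 𝓝 x, -ρ z / κ < min δ δ' / 2 := by
    have hc : ContinuousAt (fun z => -ρ z / κ) x := hρ.continuousAt.neg.div_const κ
    refine hc.eventually_lt continuousAt_const ?_
    rw [hρx]; simp; exact ⟨hδ, hδ'⟩
  filter_upwards [hsmall, Metric.ball_mem_nhds x (show 0 < min δ δ' / 2 by positivity)]
    with z hz hzb hzneg
  set s₁ := -ρ z / κ with hs₁
  have hs₁0 : 0 < s₁ := div_pos (neg_pos.2 hzneg) hκ0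
  have hseg : ∀ s ∈ Set.Icc 0 s₁, z - s • e ∈ Metric.ball x (min δ δ') := by
    intro s hs
    rw [Metric.mem_ball, dist_eq_norm] at hzb ⊢
    have h1 : ‖s • e‖ = s := by rw [norm_smul, he, Real.norm_of_nonneg hs.1, mul_one]
    have h2 := norm_sub_le (z - x) (s • e)
    rw [show z - s • e - x = z - x - s • e by abel]
    linarith [hs.2]
  have hzball : z ∈ Metric.ball x (min δ δ') := by simpa using hseg 0 ⟨le_rfl, hs₁0.le⟩
  have hcontf : ContinuousOn (fun s : ℝ => ρ (z - s • e)) (Set.Icc 0 s₁) := by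
    intro s hs
    have h1 := (hprod _ (Metric.ball_subset_ball (min_le_left _ _) (hseg s hs))).2.2.continuousAt
    exact (ContinuousAt.comp (f := fun s : ℝ => z - s • e) (g := ρ) h1
      (by fun_prop)).continuousWithinAt
  have hgrow : 0 ≤ ρ (z - s₁ • e) := by
    have h1 := hPinc (z - s₁ • e)
      (hPball _ (Metric.ball_subset_ball (min_le_right _ _) (hseg s₁ ⟨hs₁0.le, le_rfl⟩))) z
      (hPball _ (Metric.ball_subset_ball (min_le_right _ _) hzball))
    simp only [innerSL_apply_apply] at h1
    rw [sub_sub_cancel_left, inner_neg_right, real_inner_smul_right, norm_neg, norm_smul, he,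
      Real.norm_of_nonneg hs₁0.le, Real.norm_eq_abs] at h1
    have h2 := (abs_le.1 h1).1
    have h3 : κ * s₁ = -ρ z := by rw [hs₁]; field_simp
    have h4 : ⟪G, e⟫ = -2 * κ := by rw [hκ]; ring
    rw [h4] at h2
    nlinarith
  obtain ⟨s, hs, hs0⟩ := intermediate_value_Icc hs₁0.le hcontf
    (show (0 : ℝ) ∈ Set.Icc _ _ from ⟨by simpa using hzneg.le, hgrow⟩)
  have hspos : 0 < s := by
    refine lt_of_le_of_ne hs.1 ?_
    rintro rfl
    simp only [zero_smul, sub_zero] at hs0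
    linarith
  obtain ⟨h1, h2, -⟩ := hprod _ (Metric.ball_subset_ball (min_le_left _ _) (hseg s hs))
  have h3 := hclos _ h1 (h2 hs0)
  have hin : ⟪z - s • e, e⟫ = ⟪z, e⟫ - s := by
    rw [inner_sub_left, real_inner_smul_left, hee, mul_one]
  have h4 : z - s • e - ⟪z - s • e, e⟫ • e = z - ⟪z, e⟫ • e := by rw [hin]; module
  rw [h4, hin] at h3
  have hzU : z ∈ U := (hprod z (Metric.ball_subset_ball (min_le_left _ _) hzball)).1
  exact (hΩ z hzU).2 (by linarith)

theorem hausdorffMeasure_finrank_ne_zero {E : Type*} [NormedAddCommGroup E] [NormedSpace ℝ E]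
    [FiniteDimensional ℝ E] [MeasurableSpace E] [BorelSpace E] {x : E} {s : Set E}
    (hs : s ∈ nhds x) : Measure.hausdorffMeasure (Module.finrank ℝ E : ℝ) s ≠ 0 :=
  (Measure.measure_pos_of_mem_nhds _ hs).ne'

/-- A neighbourhood of a Lipschitz boundary point has positive surface measure. -/
theorem hausdorffMeasure_frontier_inter_pos {Ω U : Set (Space N)} {x e : Space N}
    {h : Space N → ℝ} {L : NNReal} (hU : IsOpen U) (hxU : x ∈ U) (he : ‖e‖ = 1)
    (hh : LipschitzWith L h) (hΩ : ∀ y ∈ U, y ∈ Ω ↔ h (y - ⟪y, e⟫ • e) < ⟪y, e⟫)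
    (hx : x ∈ frontier Ω) {W : Set (Space N)} (hW : W ∈ 𝓝 x) :
    Measure.hausdorffMeasure ((N : ℝ) - 1) (W ∩ frontier Ω) ≠ 0 := by
  intro hnull
  have hee : ⟪e, e⟫ = 1 := by rw [real_inner_self_eq_norm_sq, he]; norm_num
  have he0 : e ≠ 0 := by rintro rfl; simp at he
  let T : Submodule ℝ (Space N) := (ℝ ∙ e)ᗮ
  have hfin : (Module.finrank ℝ T : ℝ) = (N : ℝ) - 1 := by
    have h1 := Submodule.finrank_add_finrank_orthogonal (ℝ ∙ e)
    rw [finrank_span_singleton he0, finrank_euclideanSpace_fin] at h1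
    have h2 : (1 : ℝ) + Module.finrank ℝ T = N := by exact_mod_cast h1
    linarith
  let Γ : T → Space N := fun y => (y : Space N) + h y • e
  have hye : ∀ y : T, ⟪(y : Space N), e⟫ = 0 := fun y =>
    Submodule.mem_orthogonal_singleton_iff_inner_left.1 y.2
  have hproj : ∀ (y : T) (a : ℝ), ⟪(y : Space N) + a • e, e⟫ = a ∧
      (y : Space N) + a • e - ⟪(y : Space N) + a • e, e⟫ • e = y := by
    intro y a
    have : ⟪(y : Space N) + a • e, e⟫ = a := by
      rw [inner_add_left, real_inner_smul_left, hee, hye, zero_add, mul_one]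
    exact ⟨this, by rw [this]; abel⟩
  have hΓfr : ∀ y : T, Γ y ∈ U → Γ y ∈ frontier Ω := by
    intro y hy
    rw [frontier, Set.mem_sdiff]
    constructor
    · have hlim : Tendsto (fun s : ℝ => (y : Space N) + (h y + s) • e) (𝓝[>] 0) (𝓝 (Γ y)) := by
        refine Tendsto.mono_left ?_ nhdsWithin_le_nhds
        have : Continuous fun s : ℝ => (y : Space N) + (h y + s) • e := by fun_prop
        simpa [Γ] using this.tendsto 0
      refine mem_closure_of_tendsto hlim ?_
      filter_upwards [hlim.eventually (hU.eventually_mem hy), self_mem_nhdsWithin] with s h1 h2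
      rw [hΩ _ h1, (hproj y _).2, (hproj y _).1]
      have : 0 < s := h2
      linarith
    · intro hint
      have h1 := (hΩ _ hy).1 (interior_subset hint)
      rw [(hproj y _).2, (hproj y _).1] at h1
      exact lt_irrefl _ h1
  have hxeq : h (x - ⟪x, e⟫ • e) = ⟪x, e⟫ := by
    have hc1 : Continuous fun y : Space N => h (y - ⟪y, e⟫ • e) :=
      hh.continuous.comp (by fun_prop)
    have hc2 : Continuous fun y : Space N => ⟪y, e⟫ := by fun_prop
    rcases lt_trichotomy (h (x - ⟪x, e⟫ • e)) ⟪x, e⟫ with hlt | heq | hgt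
    · exfalso
      refine hx.2 (mem_interior_iff_mem_nhds.2 ?_)
      filter_upwards [hU.mem_nhds hxU, hc1.continuousAt.eventually_lt hc2.continuousAt hlt]
        with y h1 h2 using (hΩ y h1).2 h2
    · exact heq
    · exfalso
      have : ∀ᶠ y in 𝓝 x, y ∉ Ω := by
        filter_upwards [hU.mem_nhds hxU, hc2.continuousAt.eventually_lt hc1.continuousAt hgt]
          with y h1 h2 h3
        exact lt_asymm h2 ((hΩ y h1).1 h3)
      exact mem_closure_iff_frequently.1 hx.1 this
  have hΓcont : Continuous Γ := by
    have : Continuous fun y : T => h (y : Space N) := hh.continuous.comp continuous_subtype_val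
    exact continuous_subtype_val.add (this.smul continuous_const)
  have hx₀mem : x - ⟪x, e⟫ • e ∈ T := by
    rw [Submodule.mem_orthogonal_singleton_iff_inner_left, inner_sub_left, real_inner_smul_left,
      hee]
    ring
  let x₀ : T := ⟨x - ⟪x, e⟫ • e, hx₀mem⟩
  have hΓx : Γ x₀ = x := by
    change x - ⟪x, e⟫ • e + h (x - ⟪x, e⟫ • e) • e = x
    rw [hxeq]; abel
  have hnhds : Γ ⁻¹' (W ∩ U) ∈ 𝓝 x₀ :=
    hΓcont.continuousAt (by rw [hΓx]; exact inter_mem hW (hU.mem_nhds hxU))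
  -- Projection onto e^⊥ does not increase Hausdorff measure, and the image contains a neighbourhood
  -- in a space of dimension N - 1.
  have hsub : Γ ⁻¹' (W ∩ U) ⊆ T.orthogonalProjectionOnto '' (W ∩ frontier Ω) := by
    intro y hy
    refine ⟨Γ y, ⟨hy.1, hΓfr y hy.2⟩, ?_⟩
    have h1 : T.orthogonalProjectionOnto (y : Space N) = y :=
      T.orthogonalProjectionOnto_mem_subspace_eq_self y
    have h2 : T.orthogonalProjectionOnto e = 0 :=
      Submodule.orthogonalProjectionOnto_orthogonalComplement_singleton_eq_zero e
    simp only [Γ, map_add, map_smul, h1, h2, smul_zero, add_zero]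
  have hlip : LipschitzWith 1 T.orthogonalProjectionOnto := by
    refine LipschitzWith.of_dist_le_mul fun y z => ?_
    rw [dist_eq_norm, dist_eq_norm, ← map_sub, NNReal.coe_one, one_mul]
    exact T.norm_orthogonalProjectionOnto_apply_le _
  have hzero : Measure.hausdorffMeasure (Module.finrank ℝ T : ℝ) (Γ ⁻¹' (W ∩ U)) = 0 := by
    refine measure_mono_null hsub (le_antisymm ?_ zero_le)
    have h1 := hlip.hausdorffMeasure_image_le (d := (N : ℝ) - 1) (by rw [← hfin]; positivity)
      (W ∩ frontier Ω)
    rw [hnull, mul_zero] at h1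
    rw [hfin]
    exact h1
  exact hausdorffMeasure_finrank_ne_zero hnhds hzero

/-! ### The domain and its inner normal near Φ(c) -/

theorem thickness_nonneg (C Ω : Set (Space N)) (c : Space N) : 0 ≤ thickness C Ω c :=
  Real.sSup_nonneg fun _ hr => hr.1

/-- The thickness is positive at noncritical points, since it is minimal where it vanishes. -/
theorem HasC2Boundary.thickness_pos {C Ω : Set (Space N)} (hC : HasC2Boundary C)
    (hth : ContDiffOn ℝ 2 (thickness C Ω) (frontier C)) {c : Space N} (hc : c ∈ frontier C)
    (hg : gradThickness C Ω c ≠ 0) : 0 < thickness C Ω c := by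
  refine lt_of_le_of_ne (thickness_nonneg C Ω c) fun h0 => hg ?_
  obtain ⟨γ, hγ0, hγ, hmem⟩ :=
    hC.exists_curve hc (inner_outerNormal_of_mem_tangent (gradThickness C Ω c))
  have hd : HasFDerivWithinAt (thickness C Ω) (fderivWithin ℝ (thickness C Ω) (frontier C) c)
      (frontier C) (γ 0) := by
    rw [hγ0]
    exact ((hth c hc).differentiableWithinAt (by norm_num)).hasFDerivWithinAt
  have hder := (hd.comp_hasDerivWithinAt (0 : ℝ)
    (hγ.hasDerivWithinAt (s := {ε | γ ε ∈ frontier C})) (fun ε hε => hε)).hasDerivAt hmem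
  have hmin : IsLocalMin (thickness C Ω ∘ γ) 0 := by
    refine Filter.Eventually.of_forall fun ε => ?_
    simp only [Function.comp_apply, hγ0, ← h0]
    exact thickness_nonneg C Ω _
  have h1 := hmin.hasDerivAt_eq_zero hder
  rw [← inner_gradThickness, ← Submodule.coe_inner] at h1
  exact inner_self_eq_zero.1 h1

/-- Near `Φ(c)` the domain is the sublevel set of the signed height over the graph of the
thickness function. -/
theorem ClassO.eventually_mem_iff {C Ω : Set (Space N)} (hC : IsConvexCore C) (hΩ : ClassO C Ω)
    {D : ℝ} (hD : ∀ c ∈ frontier C, ∀ r : ℝ, 0 ≤ r → c + r • outerNormal C c ∈ Ω → r ≤ D)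
    {c : Space N} (hc : c ∈ frontier C) (hd : 0 < thickness C Ω c) {p : Space N → Space N}
    {r : Space N → ℝ}
    (hp : NormalCoordinates C c (thickness C Ω c) (radialMap C Ω c) p r) {G : Space N}
    (hρ : ContDiffAt ℝ 1 (fun z => r z - thickness C Ω (p z)) (radialMap C Ω c))
    (hG : HasFDerivAt (fun z => r z - thickness C Ω (p z)) (innerSL ℝ G) (radialMap C Ω c))
    (hG0 : G ≠ 0) :
    (∀ᶠ z in 𝓝 (radialMap C Ω c), z ∈ Ω ↔ r z - thickness C Ω (p z) < 0) ∧
      ∃ (U : Set (Space N)) (e : Space N) (h : Space N → ℝ) (L : NNReal),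
        IsOpen U ∧ radialMap C Ω c ∈ U ∧ ‖e‖ = 1 ∧ LipschitzWith L h ∧
        ∀ y ∈ U, y ∈ Ω ↔ h (y - ⟪y, e⟫ • e) < ⟪y, e⟫ := by
  set x := radialMap C Ω c with hx
  have hρx : r x - thickness C Ω (p x) = 0 := by rw [hp.foot_eq, hp.height_eq, sub_self]
  have hrpos : ∀ᶠ z in 𝓝 x, 0 < r z :=
    hp.contDiffAt_height.continuousAt.eventually_const_lt (by rw [hp.height_eq]; exact hd)
  have hneg : ∀ᶠ z in 𝓝 x, z ∈ Ω → r z - thickness C Ω (p z) < 0 := by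
    filter_upwards [hp.foot_mem, hp.eq_foot_add, hrpos] with z h1 h2 h3 hz
    have hcont : Tendsto (fun s : ℝ => z + s • outerNormal C (p z)) (𝓝[>] 0) (𝓝 z) := by
      have : Continuous fun s : ℝ => z + s • outerNormal C (p z) := by fun_prop
      simpa using (this.tendsto 0).mono_left nhdsWithin_le_nhds
    obtain ⟨s, hs, hs0⟩ :=
      ((hcont.eventually (hΩ.isOpen.eventually_mem hz)).and self_mem_nhdsWithin).exists
    have hs0' : 0 < s := hs0
    -- Ω is open, so it contains points slightly higher on the same normal ray; this makes the
    -- inequality for z strict.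
    have h4 : r z + s ≤ thickness C Ω (p z) := by
      refine le_csSup ⟨D, fun t ht => hD _ h1 t ht.1 ht.2⟩ ⟨by linarith, ?_⟩
      rwa [add_smul, ← add_assoc, ← h2]
    linarith
  have hzero : ∀ᶠ z in 𝓝 x, r z - thickness C Ω (p z) = 0 → z ∈ closure Ω := by
    filter_upwards [hp.foot_mem, hp.eq_foot_add, hrpos] with z h1 h2 h3 hz
    have hpos : 0 < thickness C Ω (p z) := by linarith
    -- The supremum of the empty set is 0, so positive thickness means that the ray meets Ω.
    have hne : {t : ℝ | 0 ≤ t ∧ p z + t • outerNormal C (p z) ∈ Ω}.Nonempty := by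
      by_contra hemp
      rw [Set.not_nonempty_iff_eq_empty] at hemp
      rw [thickness, hemp, Real.sSup_empty] at hpos
      exact lt_irrefl _ hpos
    rw [Metric.mem_closure_iff]
    intro ε hε
    obtain ⟨t, ht, hlt⟩ := exists_lt_of_lt_csSup hne
      (show thickness C Ω (p z) - ε < sSup _ from sub_lt_self _ hε)
    have hle : t ≤ thickness C Ω (p z) :=
      le_csSup ⟨D, fun t ht => hD _ h1 t ht.1 ht.2⟩ ht
    refine ⟨_, ht.2, ?_⟩
    rw [dist_eq_norm]
    nth_rw 1 [h2]
    rw [add_sub_add_left_eq_sub, ← sub_smul, norm_smul, hC.boundary.norm_outerNormal h1, mul_one,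
      Real.norm_of_nonneg (by linarith)]
    linarith
  have hxΩ : x ∉ Ω := fun h => absurd (hneg.self_of_nhds h) (by rw [hρx]; exact lt_irrefl _)
  have hxfr : x ∈ frontier Ω := by
    rw [hΩ.isOpen.frontier_eq]; exact ⟨hzero.self_of_nhds hρx, hxΩ⟩
  have hxC : x ∉ C := by
    intro h
    have h1 := hC.inner_outerNormal_nonpos hc h
    rw [hx, radialMap, add_sub_cancel_left, real_inner_smul_left, real_inner_self_eq_norm_sq,
      hC.boundary.norm_outerNormal hc] at h1
    linarith
  obtain ⟨U, e, h, L, hU, hxU, he, hh, hUΩ⟩ := hΩ.lipschitz x ⟨hxfr, hxC⟩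
  refine ⟨?_, U, e, h, L, hU, hxU, he, hh, hUΩ⟩
  filter_upwards [hneg, eventually_mem_of_sublevel hU hxU he hh hUΩ hρ hG hG0 hρx hneg hzero]
    with z h1 h2 using ⟨h1, h2⟩

/-- C is bounded, so only parameters in [0, B + 1] matter for z within distance 1 of x; on this
compact interval, missing the closed set C is stable. -/
theorem eventually_disjoint_ray {C : Set (Space N)} (hC : IsCompact C) {x : Space N}
    {m : Space N → Space N} (hm : ContinuousAt m x) (hunit : ∀ᶠ z in 𝓝 x, ‖m z‖ = 1)
    (hx : ∀ t : ℝ, 0 ≤ t → x + t • m x ∉ C) :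
    ∀ᶠ z in 𝓝 x, ∀ t : ℝ, 0 ≤ t → z + t • m z ∉ C := by
  obtain ⟨B, hB⟩ := hC.isBounded.subset_closedBall x
  have h1 : ∀ᶠ z in 𝓝 x, ∀ t ∈ Set.Icc (0 : ℝ) (B + 1), z + t • m z ∉ C := by
    refine isCompact_Icc.eventually_forall_of_forall_eventually fun t ht => ?_
    have hc : ContinuousAt (fun q : Space N × ℝ => q.1 + q.2 • m q.1) (x, t) := by
      have : ContinuousAt (fun q : Space N × ℝ => m q.1) (x, t) :=
        ContinuousAt.comp (g := m) (f := Prod.fst) hm continuousAt_fst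
      exact continuousAt_fst.add (continuousAt_snd.smul this)
    exact hc.eventually (hC.isClosed.isOpen_compl.eventually_mem (hx t ht.1))
  filter_upwards [h1, hunit, Metric.closedBall_mem_nhds x one_pos] with z h2 h3 h4 t ht hmem
  refine h2 t ⟨ht, ?_⟩ hmem
  have h5 := hB hmem
  rw [Metric.mem_closedBall, dist_eq_norm] at h4 h5
  have h6 : ‖t • m z‖ = t := by rw [norm_smul, h3, Real.norm_of_nonneg ht, mul_one]
  have h7 := norm_sub_le (z + t • m z - x) (z - x)
  rw [show z + t • m z - x - (z - x) = t • m z by abel, h6] at h7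
  linarith

/-- The inner normal at `Φ(c)` is proportional to `(I - d S)⁻¹ ∇d - ν`, and its half-line
meets `C`. -/
theorem ClassO.innerNormal_radialMap {C Ω : Set (Space N)} (hC : IsConvexCore C)
    (hΩ : ClassO C Ω)
    {D : ℝ} (hD : ∀ c ∈ frontier C, ∀ r : ℝ, 0 ≤ r → c + r • outerNormal C c ∈ Ω → r ≤ D)
    (hth : ContDiffOn ℝ 2 (thickness C Ω) (frontier C))
    {c : Space N} (hc : c ∈ frontier C) (hd : 0 < thickness C Ω c) {u : tangent C c}
    (hu : transportOperator C Ω c u = gradThickness C Ω c) :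
    innerNormal Ω (radialMap C Ω c) =
        ‖outerNormal C c - (u : Space N)‖⁻¹ • ((u : Space N) - outerNormal C c) ∧
      ∃ t : ℝ, 0 ≤ t ∧ radialMap C Ω c + t • innerNormal Ω (radialMap C Ω c) ∈ C := by
  obtain ⟨p, r, hp, hρ, hG⟩ := hC.exists_height hc hd.le hth hu
  have hν := hC.boundary.norm_outerNormal hc
  have hG0 : outerNormal C c - (u : Space N) ≠ 0 := by
    intro h0
    have h1 := inner_outerNormal_of_mem_tangent u
    rw [← sub_eq_zero.1 h0, real_inner_self_eq_norm_sq, hν] at h1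
    norm_num at h1
  obtain ⟨hiff, U, e, h, L, hU, hxU, he, hh, hUΩ⟩ :=
    hΩ.eventually_mem_iff hC hD hc hd hp hρ hG hG0
  set x := radialMap C Ω c with hx
  set ρ : Space N → ℝ := fun z => r z - thickness C Ω (p z) with hρdef
  have hρx : ρ x = 0 := by rw [hρdef]; simp only [hp.foot_eq, hp.height_eq, sub_self]
  have hgradx : gradient ρ x = outerNormal C c - (u : Space N) := by
    refine ext_inner_right ℝ fun w => ?_
    rw [inner_gradient_left, hG.fderiv, innerSL_apply_apply]
  have hgc : ContinuousAt (gradient ρ) x :=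
    (InnerProductSpace.toDual ℝ (Space N)).symm.continuous.continuousAt.comp
      (hρ.fderiv_right (m := 0) (by norm_num)).continuousAt
  have hgne : ∀ᶠ z in 𝓝 x, gradient ρ z ≠ 0 := hgc.eventually_ne (by rwa [hgradx])
  have hnormal : ∀ᶠ z in 𝓝 x, ρ z = 0 →
      IsInnerUnitNormal Ω z (-(‖gradient ρ z‖⁻¹ • gradient ρ z)) := by
    filter_upwards [hgne, hiff.eventually_nhds, hρ.eventually (by simp)] with z h1 h2 h3 h4
    refine isInnerUnitNormal_of_hasFDerivAt ?_ h1 h4 (h2.mono fun y hy => hy.2)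
      (h2.mono fun y hy hpos hmem => lt_asymm hpos (hy.1 hmem))
    rw [innerSL_gradient]
    exact (h3.differentiableAt (by norm_num)).hasFDerivAt
  have hfr : ∀ᶠ z in 𝓝 x, z ∈ frontier Ω → ρ z = 0 := by
    filter_upwards [hiff.eventually_nhds, hρ.eventually (by simp)] with z h2 h3 h4
    rw [hΩ.isOpen.frontier_eq] at h4
    rcases lt_trichotomy (ρ z) 0 with h5 | h5 | h5
    · exact absurd (h2.self_of_nhds.2 h5) h4.2
    · exact h5
    · have h6 : ∀ᶠ y in 𝓝 z, y ∉ Ω := by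
        filter_upwards [h2, h3.continuousAt.eventually_const_lt h5] with y h7 h8 h9
        exact lt_asymm h8 (h7.1 h9)
      exact absurd h6 (mem_closure_iff_frequently.1 h4.1)
  have hxn := hnormal.self_of_nhds hρx
  have hxeq := hxn.innerNormal_eq
  refine ⟨?_, ?_⟩
  · rw [hxeq, hgradx, ← smul_neg, neg_sub]
  -- The normal field is continuous along ∂Ω near x, so if the ray at x missed C, all nearby
  -- boundary points would violate the normal property, and they have positive surface measure.
  by_contra! hmiss
  rw [hxeq] at hmiss
  have hmc : ContinuousAt (fun z => -(‖gradient ρ z‖⁻¹ • gradient ρ z)) x :=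
    ((hgc.norm.inv₀ (norm_ne_zero_iff.2 hgne.self_of_nhds)).smul hgc).neg
  have hunit : ∀ᶠ z in 𝓝 x, ‖-(‖gradient ρ z‖⁻¹ • gradient ρ z)‖ = 1 := by
    filter_upwards [hgne] with z hz
    rw [norm_neg, norm_smul, norm_inv, norm_norm, inv_mul_cancel₀ (norm_ne_zero_iff.2 hz)]
  have hbad := (eventually_disjoint_ray hC.isCompact hmc hunit hmiss).and (hnormal.and hfr)
  refine hausdorffMeasure_frontier_inter_pos hU hxU he hh hUΩ hxn.2.1 hbad ?_
  have hae := hΩ.normal_property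
  rw [GeometricNormalProperty, ae_restrict_iff' isClosed_frontier.measurableSet, ae_iff] at hae
  refine measure_mono_null ?_ hae
  rintro z ⟨⟨h1, h2, h3⟩, h4⟩ h5
  obtain ⟨t, ht, hmem⟩ := h5 h4 _ (h2 (h3 h4))
  exact h1 t ht hmem

/-! ### The displacement -/

/-- With a = ‖u‖ and τ = 2d²a²/R, the left side is the squared distance from c - Rν to c + dν + (d +
τ)(u - ν). In its expansion the gain 2Rτ exceeds the losses d²a² = Rτ/2, 2dτa² ≤ Rτ/4 and τ²(1 + a²)
≤ Rτ. -/
theorem interior_ball_estimate {R d a κ D : ℝ} (hR : 0 < R) (hd : 0 ≤ d) (hdD : d ≤ D)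
    (hκR : κ ≤ R / 8) (hκD : D * κ ≤ R ^ 2 / 4) (hκ : d * a ^ 2 ≤ κ) :
    (R - 2 * d ^ 2 * a ^ 2 / R) ^ 2 + (d + 2 * d ^ 2 * a ^ 2 / R) ^ 2 * a ^ 2 ≤ R ^ 2 := by
  set τ := 2 * d ^ 2 * a ^ 2 / R with hτ
  have hτ0 : 0 ≤ τ := by positivity
  have hRτ : R * τ = 2 * d ^ 2 * a ^ 2 := by rw [hτ]; field_simp
  have hq : 0 ≤ d * a ^ 2 := by positivity
  have h1 : d * a ^ 2 * τ ≤ R / 8 * τ := by gcongr; linarith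
  have h2 : R * (τ * (1 + a ^ 2)) ≤ R * R := by
    have e : R * (τ * (1 + a ^ 2)) = 2 * (d * (d * a ^ 2)) + 2 * (d * a ^ 2) ^ 2 := by
      rw [← mul_assoc, hRτ]; ring
    have h3 : d * (d * a ^ 2) ≤ D * κ := mul_le_mul hdD hκ hq (hd.trans hdD)
    have h4 : (d * a ^ 2) ^ 2 ≤ (R / 8) ^ 2 := by gcongr; linarith
    nlinarith [sq_nonneg R]
  have h5 : τ * (1 + a ^ 2) ≤ R := le_of_mul_le_mul_left h2 hR
  have h6 : τ * (τ * (1 + a ^ 2)) ≤ τ * R := by gcongr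
  nlinarith

/-- The displacement is `d ν + s ((I - d S)⁻¹ ∇d - ν)` with `s ≥ d`, and `s - d` is of second order
in the gradient. -/
theorem ClassO.exists_displacement_eq {C Ω : Set (Space N)} (hC : IsConvexCore C)
    (hΩ : ClassO C Ω) {R : ℝ} (hR : 0 < R)
    (hball : ∀ c ∈ frontier C, Metric.closedBall (c - R • outerNormal C c) R ⊆ C)
    {D : ℝ} (hD : ∀ c ∈ frontier C, ∀ r : ℝ, 0 ≤ r → c + r • outerNormal C c ∈ Ω → r ≤ D)
    (hth : ContDiffOn ℝ 2 (thickness C Ω) (frontier C))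
    {c : Space N} (hc : c ∈ frontier C) (hd : 0 < thickness C Ω c) {u : tangent C c}
    (hu : transportOperator C Ω c u = gradThickness C Ω c) :
    ∃ s : ℝ, thickness C Ω c ≤ s ∧ displacement C Ω c =
        thickness C Ω c • outerNormal C c + s • ((u : Space N) - outerNormal C c) ∧
      c + displacement C Ω c ∈ C ∧
      ((R - 2 * thickness C Ω c ^ 2 * ‖u‖ ^ 2 / R) ^ 2 +
          (thickness C Ω c + 2 * thickness C Ω c ^ 2 * ‖u‖ ^ 2 / R) ^ 2 * ‖u‖ ^ 2 ≤ R ^ 2 →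
        s - thickness C Ω c ≤ 2 * thickness C Ω c ^ 2 * ‖u‖ ^ 2 / R) := by
  obtain ⟨hn, t, ht0, ht⟩ := hΩ.innerNormal_radialMap hC hD hth hc hd hu
  have hν := hC.boundary.norm_outerNormal hc
  set d := thickness C Ω c with hddef
  set ν := outerNormal C c with hνdef
  have hνν : ⟪ν, ν⟫ = 1 := by rw [real_inner_self_eq_norm_sq, hν]; norm_num
  have huν : ⟪ν, (u : Space N)⟫ = 0 := inner_outerNormal_of_mem_tangent u
  have hℓ : 0 < ‖ν - (u : Space N)‖ := by
    rw [norm_pos_iff]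
    intro h0
    rw [← sub_eq_zero.1 h0, hνν] at huν
    exact one_ne_zero huν
  set ℓ := ‖ν - (u : Space N)‖ with hℓdef
  let H : Set ℝ := {t : ℝ | 0 ≤ t ∧ radialMap C Ω c + t • innerNormal Ω (radialMap C Ω c) ∈ C}
  have hHclosed : IsClosed H := by
    refine IsClosed.inter isClosed_Ici (hC.isCompact.isClosed.preimage ?_)
    fun_prop
  have hHbdd : BddBelow H := ⟨0, fun t ht => ht.1⟩
  -- H is closed and nonempty, so the infimum is attained and F(c) lies in C.
  have hmem : hitTime C Ω (radialMap C Ω c) ∈ H := hHclosed.csInf_mem ⟨t, ht0, ht⟩ hHbdd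
  set t₀ := hitTime C Ω (radialMap C Ω c) with ht₀
  have hpt : ∀ t : ℝ, radialMap C Ω c + t • innerNormal Ω (radialMap C Ω c) =
      c + (d • ν + (t / ℓ) • ((u : Space N) - ν)) := by
    intro t
    rw [hn, radialMap, smul_smul, div_eq_mul_inv, add_assoc]
  have hdisp : displacement C Ω c = d • ν + (t₀ / ℓ) • ((u : Space N) - ν) := by
    rw [displacement, returnMap, reciprocalMap, hpt, add_sub_cancel_left]
  have hFC : c + displacement C Ω c ∈ C := by rw [hdisp, ← hpt]; exact hmem.2
  refine ⟨t₀ / ℓ, ?_, hdisp, hFC, fun hest => ?_⟩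
  · have h1 := hC.inner_outerNormal_nonpos hc hFC
    rw [add_sub_cancel_left, hdisp, real_inner_comm, inner_add_right, real_inner_smul_right,
      real_inner_smul_right, inner_sub_right, ← hνdef, huν, hνν] at h1
    linarith
  · set τ := 2 * d ^ 2 * ‖u‖ ^ 2 / R with hτ
    have hτ0 : 0 ≤ τ := by positivity
    -- This parameter puts the point of the half-line in the interior ball at c, hence in C; the
    -- factor ℓ passes from the unit normal to u - ν.
    have hle : t₀ ≤ (d + τ) * ℓ := by
      refine csInf_le hHbdd ⟨by positivity, ?_⟩
      rw [hpt, mul_div_cancel_right₀ _ hℓ.ne']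
      apply hball c hc
      rw [Metric.mem_closedBall, dist_eq_norm, ← hνdef,
        show c + (d • ν + (d + τ) • ((u : Space N) - ν)) - (c - R • ν) =
          (R - τ) • ν + (d + τ) • (u : Space N) by module]
      refine le_of_sq_le_sq ?_ hR.le
      rw [norm_add_sq_real, real_inner_smul_left, real_inner_smul_right, huν, norm_smul, norm_smul,
        hν, Real.norm_eq_abs, Real.norm_eq_abs, mul_pow, mul_pow, sq_abs, sq_abs, ← Submodule.coe_norm]
      linarith
    rw [← div_le_iff₀ hℓ] at hle
    linarith

/-! ### Norm estimates -/

theorem norm_normalize_sub_normalize_le {E : Type*} [NormedAddCommGroup E] [NormedSpace ℝ E]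
    {x y : E} (hy : y ≠ 0) : ‖‖x‖⁻¹ • x - ‖y‖⁻¹ • y‖ ≤ 2 * ‖x - y‖ / ‖y‖ := by
  have hy0 := norm_pos_iff.2 hy
  rw [le_div_iff₀ hy0]
  rcases eq_or_ne x 0 with rfl | hx
  · simp only [smul_zero, zero_sub, norm_neg, norm_smul, norm_inv, norm_norm]
    field_simp
    linarith
  have hx0 := norm_pos_iff.2 hx
  have h1 : ‖‖x‖⁻¹ • x - ‖y‖⁻¹ • y‖ * ‖y‖ = ‖(‖y‖ - ‖x‖) • (‖x‖⁻¹ • x) + (x - y)‖ := by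
    rw [mul_comm, ← norm_norm y, ← norm_smul, norm_norm]
    congr 1
    rw [smul_sub, sub_smul, smul_smul ‖y‖ ‖y‖⁻¹, mul_inv_cancel₀ hy0.ne', smul_smul ‖x‖ ‖x‖⁻¹,
      mul_inv_cancel₀ hx0.ne', one_smul, one_smul]
    abel
  have h2 : ‖(‖y‖ - ‖x‖) • (‖x‖⁻¹ • x)‖ ≤ ‖x - y‖ := by
    rw [norm_smul, norm_smul, norm_inv, norm_norm, inv_mul_cancel₀ hx0.ne', mul_one, norm_sub_rev x y]
    exact abs_norm_sub_norm_le y x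
  rw [h1]
  linarith [norm_add_le ((‖y‖ - ‖x‖) • (‖x‖⁻¹ • x)) (x - y)]

theorem norm_normalize_le_one {E : Type*} [NormedAddCommGroup E] [NormedSpace ℝ E] (x : E) :
    ‖‖x‖⁻¹ • x‖ ≤ 1 := by
  rw [norm_smul, norm_inv, norm_norm]
  exact inv_mul_le_one

/-- If d‖u‖² ≤ κ, then d + d‖u‖ ≤ 2d + d‖u‖² ≤ 2D' + κ turns `hgood` into the third term of the
constant. Otherwise the crude bound B + d‖u‖ ≤ B + D' + d‖u‖² is absorbed because d‖u‖²/κ > 1. -/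
theorem norm_sub_smul_le {E : Type*} [NormedAddCommGroup E] [NormedSpace ℝ E] {f u : E}
    {d B D' κ R : ℝ} (hR : 0 < R) (hκ0 : 0 < κ) (hd : 0 < d) (hdD : d ≤ D') (hB0 : 0 ≤ B)
    (hfB : ‖f‖ ≤ B)
    (hgood : d * ‖u‖ ^ 2 ≤ κ → ‖f - d • u‖ ≤ 2 * d ^ 2 * ‖u‖ ^ 2 / R * (1 + ‖u‖)) :
    ‖f - d • u‖ ≤ (1 + (B + D') / κ + 2 * (2 * D' + κ) / R) * d * ‖u‖ ^ 2 := by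
  have hD'0 : 0 ≤ D' := hd.le.trans hdD
  have hda : d * ‖u‖ ≤ d + d * ‖u‖ ^ 2 := by
    nlinarith [sq_nonneg (‖u‖ - 1), norm_nonneg u]
  rw [mul_assoc]
  have hq : 0 ≤ d * ‖u‖ ^ 2 := by positivity
  rcases le_or_gt (d * ‖u‖ ^ 2) κ with h | h
  · refine (hgood h).trans ?_
    have e : 2 * d ^ 2 * ‖u‖ ^ 2 / R * (1 + ‖u‖) =
        2 * (d + d * ‖u‖) / R * (d * ‖u‖ ^ 2) := by ring
    rw [e]
    refine mul_le_mul_of_nonneg_right ?_ hq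
    have h1 : 2 * (d + d * ‖u‖) / R ≤ 2 * (2 * D' + κ) / R := by gcongr 2 * ?_ / R; linarith
    have h2 : 0 ≤ (B + D') / κ := by positivity
    linarith
  · have h1 : ‖f - d • u‖ ≤ B + d * ‖u‖ := by
      have := norm_sub_le f (d • u)
      rw [norm_smul, Real.norm_of_nonneg hd.le] at this
      linarith
    have h2 : B + D' ≤ (B + D') / κ * (d * ‖u‖ ^ 2) := by
      rw [div_mul_eq_mul_div, le_div_iff₀ hκ0]
      gcongr
    have h3 : 0 ≤ 2 * (2 * D' + κ) / R * (d * ‖u‖ ^ 2) := by positivity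
    rw [add_mul, add_mul, one_mul]
    linarith

/-- The directions of f and g are compared through that of u, at costs 8d/R and 2d/R. The terms 2
and 2/κ cover the cases ‖g‖ ≥ 1 and d‖u‖² > κ, where the trivial bound 2 is enough. -/
theorem norm_neg_normalize_add_normalize_le {E : Type*} [NormedAddCommGroup E] [NormedSpace ℝ E]
    {f u g : E} {d κ R : ℝ} (hR : 0 < R) (hκ0 : 0 < κ) (hd : 0 < d) (hu0 : u ≠ 0)
    (hug : ‖u‖ ≤ ‖g‖) (hgu : ‖g - u‖ ≤ d * (‖u‖ / R))
    (hgood : d * ‖u‖ ^ 2 ≤ κ → ‖f - d • u‖ ≤ 2 * d ^ 2 * ‖u‖ ^ 2 / R * (1 + ‖u‖)) :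
    ‖-(‖g‖⁻¹ • g) + ‖f‖⁻¹ • f‖ ≤ (2 + 2 / κ + 10 / R) * (d + ‖g‖) := by
  have ha0 : 0 < ‖u‖ := norm_pos_iff.2 hu0
  have htriv : ‖-(‖g‖⁻¹ • g) + ‖f‖⁻¹ • f‖ ≤ 2 := by
    have h1 := norm_add_le (-(‖g‖⁻¹ • g)) (‖f‖⁻¹ • f)
    have h2 := norm_normalize_le_one g
    have h3 := norm_normalize_le_one f
    rw [norm_neg] at h1
    linarith
  have hexp : (2 + 2 / κ + 10 / R) * (d + ‖g‖) = 2 * d + 2 / κ * d + 10 / R * d + (2 * ‖g‖ + 2 / κ * ‖g‖ +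
    10 / R * ‖g‖) := by ring
  have e1 : 0 ≤ 2 / κ * d := by positivity
  have e2 : 0 ≤ 10 / R * d := by positivity
  have e3 : 0 ≤ 2 / κ * ‖g‖ := by positivity
  have e4 : 0 ≤ 10 / R * ‖g‖ := by positivity
  have e5 := norm_nonneg g
  rw [hexp]
  rcases le_or_gt 1 ‖g‖ with h1 | h1
  · linarith
  have hu1 : ‖u‖ ≤ 1 := hug.trans h1.le
  rcases le_or_gt (d * ‖u‖ ^ 2) κ with h | h
  · have hA : ‖‖f‖⁻¹ • f - ‖u‖⁻¹ • u‖ ≤ 8 / R * d := by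
      have hdu : d • u ≠ 0 :=
        smul_ne_zero hd.ne' hu0
      have h2 := norm_normalize_sub_normalize_le (x := f) hdu
      rw [norm_smul, Real.norm_of_nonneg hd.le, smul_smul, mul_inv,
        mul_comm d⁻¹, mul_assoc, inv_mul_cancel₀ hd.ne', mul_one] at h2
      refine h2.trans ?_
      rw [div_le_iff₀ (by positivity)]
      have h3 : 2 * d ^ 2 * ‖u‖ ^ 2 / R * (1 + ‖u‖) ≤ 2 * d ^ 2 * ‖u‖ / R * 2 := by
        gcongr
        · nlinarith
        · linarith
      have h4 : 8 / R * d * (d * ‖u‖) = 2 * (2 * d ^ 2 * ‖u‖ / R * 2) := by ring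
      rw [h4]
      linarith [hgood h]
    have hBd : ‖‖g‖⁻¹ • g - ‖u‖⁻¹ • u‖ ≤ 2 / R * d := by
      refine (norm_normalize_sub_normalize_le hu0).trans ?_
      rw [div_le_iff₀ ha0]
      have h4 : 2 / R * d * ‖u‖ = 2 * (d * (‖u‖ / R)) := by ring
      rw [h4]
      linarith
    have hsum : -(‖g‖⁻¹ • g) + ‖f‖⁻¹ • f =
        (‖f‖⁻¹ • f - ‖u‖⁻¹ • u) -
          (‖g‖⁻¹ • g - ‖u‖⁻¹ • u) := by
      abel
    have h5 := norm_sub_le (‖f‖⁻¹ • f - ‖u‖⁻¹ • u)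
      (‖g‖⁻¹ • g - ‖u‖⁻¹ • u)
    rw [← hsum] at h5
    have h6 : 10 / R * d = 8 / R * d + 2 / R * d := by ring
    linarith
  · have h2 : κ ≤ d := by
      have : ‖u‖ ^ 2 ≤ 1 := pow_le_one₀ (norm_nonneg _) hu1
      nlinarith
    have h3 : 2 ≤ 2 / κ * d := by
      rw [div_mul_eq_mul_div, le_div_iff₀ hκ0]; linarith
    linarith

end ReturnMap

/-! ### The main theorem -/

theorem mainTheorem12 (N : ℕ) (C : Set (Space N)) (hC : IsConvexCore C) (D : ℝ) :
    ∃ K : ℝ, 0 < K ∧ ∀ Ω : Set (Space N), ClassO C Ω →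
      (∀ c ∈ frontier C, ∀ r : ℝ, 0 ≤ r → c + r • outerNormal C c ∈ Ω → r ≤ D) →
      ContDiffOn ℝ 2 (thickness C Ω) (frontier C) →
      ∀ c ∈ frontier C, c ∉ criticalSet C Ω →
        -- `I - d S` is invertible
        (transportOperator C Ω c).IsInvertible ∧
        -- leading-order form of the displacement
        ‖displacement C Ω c -
            thickness C Ω c • ((transportOperator C Ω c).inverse (gradThickness C Ω c) : Space N)‖
          ≤ K * thickness C Ω c * ‖gradThickness C Ω c‖ ^ 2 ∧
        -- the displacement is nonzero and determines the descent direction and the gradient line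
        correctedDisplacement C Ω c ≠ 0 ∧
        descentDirection C Ω c =
          -(‖correctedDisplacement C Ω c‖⁻¹ • correctedDisplacement C Ω c) ∧
        Submodule.span ℝ {gradThickness C Ω c} =
          Submodule.span ℝ {correctedDisplacement C Ω c} ∧
        -- without the correction by `I - d S`, this still holds to leading order
        ‖(descentDirection C Ω c : Space N) +
            ‖displacement C Ω c‖⁻¹ • displacement C Ω c‖
          ≤ K * (thickness C Ω c + ‖gradThickness C Ω c‖) := by
  obtain ⟨R, hR, hball⟩ := hC.exists_interior_ball
  set D' := max D 0 with hD'
  have hD'0 : 0 ≤ D' := le_max_right _ _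
  -- These are the two smallness conditions of `interior_ball_estimate`; D' + 1 avoids a zero
  -- denominator.
  set κ := min (R / 8) (R ^ 2 / (4 * (D' + 1))) with hκdef
  have hκ0 : 0 < κ := by positivity
  have hκR : κ ≤ R / 8 := min_le_left _ _
  have hκD : D' * κ ≤ R ^ 2 / 4 := by
    have h1 : κ ≤ R ^ 2 / (4 * (D' + 1)) := min_le_right _ _
    rw [le_div_iff₀ (by positivity)] at h1
    nlinarith
  set B := Metric.diam C with hB
  have hB0 : 0 ≤ B := Metric.diam_nonneg
  set K₁ := 1 + (B + D') / κ + 2 * (2 * D' + κ) / R with hK₁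
  set K₂ := 2 + 2 / κ + 10 / R with hK₂
  have hK₁0 : 0 < K₁ := by positivity
  have hK₂0 : 0 < K₂ := by positivity
  refine ⟨K₁ + K₂, by positivity, fun Ω hΩ hD hth c hc hcrit => ?_⟩
  have hg : gradThickness C Ω c ≠ 0 := fun h0 => hcrit ⟨hc, h0⟩
  have hd := hC.boundary.thickness_pos hth hc hg
  have hdD : thickness C Ω c ≤ D' :=
    Real.sSup_le (fun r hr => (hD c hc r hr.1 hr.2).trans (le_max_left _ _)) hD'0
  obtain ⟨E, hE⟩ := hC.exists_equiv_transportOperator hc hd.le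
  set u := E.symm (gradThickness C Ω c) with hudef
  have hu : transportOperator C Ω c u = gradThickness C Ω c := by
    rw [← hE]; exact E.apply_symm_apply _
  have hinv : (transportOperator C Ω c).inverse (gradThickness C Ω c) = u := by
    rw [← hE, ContinuousLinearMap.inverse_equiv]; rfl
  obtain ⟨s, hds, hdisp, hFC, hest⟩ := hΩ.exists_displacement_eq hC hR hball hD hth hc hd hu
  have hν := hC.boundary.norm_outerNormal hc
  have hug : ‖u‖ ≤ ‖gradThickness C Ω c‖ := by
    have := hC.norm_le_transportOperator hc hd.le u
    rwa [hu] at this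
  have hgu : ‖gradThickness C Ω c - u‖ ≤ thickness C Ω c * (‖u‖ / R) := by
    have := hC.norm_transportOperator_sub_le hR hball hc hd.le u
    rwa [hu] at this
  have hu0 : u ≠ 0 := fun h0 => hg (by rw [← hu, h0, map_zero])
  have hs0 : 0 < s := hd.trans_le hds
  have hproj : (tangent C c).orthogonalProjectionOnto (displacement C Ω c) = s • u := by
    have h1 : (tangent C c).orthogonalProjectionOnto (outerNormal C c) = 0 :=
      Submodule.orthogonalProjectionOnto_orthogonalComplement_singleton_eq_zero _
    have h2 : (tangent C c).orthogonalProjectionOnto (u : Space N) = u :=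
      (tangent C c).orthogonalProjectionOnto_mem_subspace_eq_self u
    rw [hdisp, map_add, map_smul, map_smul, map_sub, h1, h2, smul_zero, zero_add, sub_zero]
  have hcorr : correctedDisplacement C Ω c = s • gradThickness C Ω c := by
    rw [correctedDisplacement, hproj, map_smul, hu]
  -- The whole error is carried by s - d, which is quadratic in ‖u‖ when d‖u‖² ≤ κ.
  have hdiff : displacement C Ω c - thickness C Ω c • (u : Space N) =
      (s - thickness C Ω c) • ((u : Space N) - outerNormal C c) := by
    rw [hdisp]; module
  set d := thickness C Ω c with hddef
  set g := gradThickness C Ω c with hgdef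
  set f := displacement C Ω c with hfdef
  have hfB : ‖f‖ ≤ B := by
    have := Metric.dist_le_diam_of_mem hC.isCompact.isBounded hFC
      (hC.isCompact.isClosed.frontier_subset hc)
    rwa [dist_eq_norm, add_sub_cancel_left] at this
  have hgood : d * ‖u‖ ^ 2 ≤ κ →
      ‖f - d • (u : Space N)‖ ≤ 2 * d ^ 2 * ‖u‖ ^ 2 / R * (1 + ‖u‖) := by
    intro h
    have h1 := hest (interior_ball_estimate hR hd.le hdD hκR hκD h)
    have h2 := norm_sub_le (u : Space N) (outerNormal C c)
    rw [hν, ← Submodule.coe_norm] at h2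
    rw [hdiff, norm_smul, Real.norm_of_nonneg (by linarith)]
    gcongr
    linarith
  have hp1 : ‖f - d • (u : Space N)‖ ≤ K₁ * d * ‖u‖ ^ 2 :=
    norm_sub_smul_le hR hκ0 hd hdD hB0 hfB hgood
  have hp3 : ‖-(‖g‖⁻¹ • (g : Space N)) + ‖f‖⁻¹ • f‖ ≤ K₂ * (d + ‖g‖) :=
    norm_neg_normalize_add_normalize_le (u := (u : Space N)) hR hκ0 hd (by simpa using hu0)
      hug hgu hgood
  refine ⟨⟨E, hE⟩, ?_, ?_, ?_, ?_, ?_⟩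
  · rw [hinv]
    refine hp1.trans ?_
    gcongr
    linarith
  · rw [hcorr]; exact smul_ne_zero hs0.ne' hg
  · rw [hcorr, descentDirection, norm_smul, Real.norm_of_nonneg hs0.le, smul_smul, mul_inv,
      mul_comm s⁻¹, mul_assoc, inv_mul_cancel₀ hs0.ne', mul_one]
  · rw [hcorr]
    exact (Submodule.span_singleton_smul_eq (IsUnit.mk0 s hs0.ne') g).symm
  · rw [descentDirection, Submodule.coe_neg, Submodule.coe_smul]
    refine hp3.trans ?_
    gcongr
    linarith
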